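/- Fix the number $m\ge 0$ of breakpoints. An instance of the single-item economic lot-sizing problem with backlogging and piecewise-linear production costs consists of a number $T\ge 1$ of periods, demands $d_j\ge 0$ ($1\le j\le T$), breakpoints $0=B_0<B_1<\dots<B_m<B_{m+1}=\infty$ that are the same in all periods, real numbers $s_{j,\ell},p_{j,\ell}$ ($1\le j\le T$, $1\le \ell\le m+1$), and inventory cost functions $H_j:\mathbb R\to\mathbb R$ with $H_j(0)=0$ that are concave on $(-\infty,0]$ and concave on $[0,\infty)$. The production cost in period $j$ is $P_j(0)=0$ and $P_j(x)=s_{j,\ell}+p_{j,\ell}x$ for $B_{\ell-1}<x\le B_\ell$. Assume that every $P_j$ is lower semicontinuous on $[0,\infty)$. For $1\le u\le T$ let $\Psi_u$ be the optimal cost-to-go $$\Psi_u=\min\Big\{\sum_{j=u}^T\big(P_j(X_j)+H_j(I_j)\big)\ :\ X_j\ge 0,\ I_j=I_{j-1}+X_j-d_j\ (u\le j\le T),\ I_{u-1}=I_T=0\Big\}.$$ Then for every fixed $m$ there is an algorithm that, for every instance with $m$ breakpoints, computes all the values $\Psi_1,\dots,\Psi_T$ in $O(T^{m+2})$ total time,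 where the implied constant depends only on $m$; in particular it computes the optimal value $\Psi_1$ of the lot-sizing problem in $O(T^{m+2})$ time. (Time is the number of elementary operations of a random access machine with unit cost that works exactly with real numbers using $+,-,\cdot$ and comparisons, whose integer words are bounded by a polynomial in $T$ depending only on $m$, and for which an evaluation of one of the functions $H_j$ at a given point is one operation.) -/

import Mathlib

namespace LotSizing

/-! ## The single-item economic lot-sizing problem with piecewise linear production costs -/

/-- An instance with `m` stationary breakpoints and `T` periods.  Periods are numbered
`0, …, T - 1`, the pieces of the production cost functions `0, …, m`, and the breakpoints
`0 < B 0 < ⋯ < B (m - 1)`.  Piece `ℓ` is the interval `(B (ℓ - 1), B ℓ]`, where the first piece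
starts at `0` and the last one is unbounded. -/
structure Instance (m T : ℕ) where
  /-- demand of each period -/
  d : Fin T → ℝ
  /-- breakpoints, the same in all periods -/
  B : Fin m → ℝ
  /-- fixed setup cost of each period and piece -/
  s : Fin T → Fin (m + 1) → ℝ
  /-- unit production cost of each period and piece -/
  p : Fin T → Fin (m + 1) → ℝ
  /-- inventory (holding and backlogging) cost functions -/
  H : Fin T → ℝ → ℝ
  d_nonneg : ∀ j, 0 ≤ d j
  B_pos : ∀ i, 0 < B i
  B_strictMono : StrictMono B
  H_zero : ∀ j, H j 0 = 0
  H_concave_backlog : ∀ j, ConcaveOn ℝ (Set.Iic 0) (H j)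
  H_concave_stock : ∀ j, ConcaveOn ℝ (Set.Ici 0) (H j)

namespace Instance

variable {m T : ℕ}

open Classical in
/-- The piece to which a production quantity `x > 0` belongs: the number of breakpoints
strictly below `x`. -/
noncomputable def piece (I : Instance m T) (x : ℝ) : Fin (m + 1) :=
  ⟨(Finset.univ.filter fun i : Fin m => I.B i < x).card, Nat.lt_succ_of_le
    ((Finset.card_filter_le _ _).trans_eq (Finset.card_fin m))⟩

open Classical in
/-- The production cost function of period `j` on `[0, ∞)`. -/
noncomputable def prodCost (I : Instance m T) (j : Fin T) (x : ℝ) : ℝ :=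
  if x = 0 then 0 else I.s j (I.piece x) + I.p j (I.piece x) * x

/-- Inventory at the end of period `j ≥ u` under the production plan `X`, if there is no
inventory before period `u` (negative values are backlogs). -/
noncomputable def inventory (I : Instance m T) (u : Fin T) (X : Fin T → ℝ) (j : Fin T) : ℝ :=
  ∑ i ∈ Finset.Icc u j, (X i - I.d i)

/-- Plans for the periods `u, …, T - 1`: production is nonnegative and nothing is left over or
backlogged after the last period. -/
def Feasible (I : Instance m T) (u : Fin T) (X : Fin T → ℝ) : Prop :=
  (∀ j, u ≤ j → 0 ≤ X j) ∧ ∀ j : Fin T, (j : ℕ) + 1 = T → I.inventory u X j = 0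

/-- Total production and inventory cost of the periods `u, …, T - 1`. -/
noncomputable def totalCost (I : Instance m T) (u : Fin T) (X : Fin T → ℝ) : ℝ :=
  ∑ j ∈ Finset.Ici u, (I.prodCost j (X j) + I.H j (I.inventory u X j))

/-- `c` is the optimal cost-to-go from period `u`: the minimum (attained) of the total cost of
the periods `u, …, T - 1`, given that there is no inventory before `u`.  For `u = 0` it is the
optimal value of the lot-sizing problem. -/
def IsCostToGo (I : Instance m T) (u : Fin T) (c : ℝ) : Prop :=
  IsLeast {c | ∃ X, I.Feasible u X ∧ I.totalCost u X = c} c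

end Instance

/-! ## A unit-cost random access machine with integer words and exact real numbers

Programs are structured.  The memory consists of arrays of natural numbers and arrays of real
numbers; an array has a fixed name in the program and is indexed by tuples of natural numbers
(a scalar variable is an array indexed by the empty tuple).  There is no conversion between real
and natural numbers, no rounding and no division.  The only other primitive is an oracle that
evaluates a family of real functions. -/

/-- Memory contents: array name, index tuple, value. -/
structure State where
  nat : ℕ → List ℕ → ℕ
  real : ℕ → List ℕ → ℝ

/-- Store `v` in the cell `i` of the natural-number array `a`. -/
def State.setNat (σ : State) (a : ℕ) (i : List ℕ) (v : ℕ) : State :=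
  { σ with nat := fun a' i' => if a' = a ∧ i' = i then v else σ.nat a' i' }

/-- Store `v` in the cell `i` of the real array `a`. -/
def State.setReal (σ : State) (a : ℕ) (i : List ℕ) (v : ℝ) : State :=
  { σ with real := fun a' i' => if a' = a ∧ i' = i then v else σ.real a' i' }

/-- Natural-number expressions; `get a k i` reads the array `a` at the `k`-tuple `i`. -/
inductive NatExpr where
  | lit (n : ℕ)
  | get (a k : ℕ) (i : Fin k → NatExpr)
  | add (e₁ e₂ : NatExpr)
  | sub (e₁ e₂ : NatExpr)
  | mul (e₁ e₂ : NatExpr)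

/-- Value of an expression (subtraction is truncated at `0`). -/
def NatExpr.eval (σ : State) : NatExpr → ℕ
  | lit n => n
  | get a _ i => σ.nat a (List.ofFn fun j => (i j).eval σ)
  | add e₁ e₂ => e₁.eval σ + e₂.eval σ
  | sub e₁ e₂ => e₁.eval σ - e₂.eval σ
  | mul e₁ e₂ => e₁.eval σ * e₂.eval σ

/-- Number of elementary operations in an expression. -/
def NatExpr.cost : NatExpr → ℕ
  | lit _ => 1
  | get _ _ i => 1 + ∑ j, (i j).cost
  | add e₁ e₂ => 1 + e₁.cost + e₂.cost
  | sub e₁ e₂ => 1 + e₁.cost + e₂.cost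
  | mul e₁ e₂ => 1 + e₁.cost + e₂.cost

/-- Real expressions; `oracle e x` asks the oracle for the value at `x` of the function
with number `e`. -/
inductive RealExpr where
  | lit (n : ℕ)
  | get (a k : ℕ) (i : Fin k → NatExpr)
  | add (x₁ x₂ : RealExpr)
  | sub (x₁ x₂ : RealExpr)
  | mul (x₁ x₂ : RealExpr)
  | oracle (e : NatExpr) (x : RealExpr)

/-- Value of a real expression, for the oracle `h`. -/
noncomputable def RealExpr.eval (h : ℕ → ℝ → ℝ) (σ : State) : RealExpr → ℝ
  | lit n => n
  | get a _ i => σ.real a (List.ofFn fun j => (i j).eval σ)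
  | add x₁ x₂ => x₁.eval h σ + x₂.eval h σ
  | sub x₁ x₂ => x₁.eval h σ - x₂.eval h σ
  | mul x₁ x₂ => x₁.eval h σ * x₂.eval h σ
  | oracle e x => h (e.eval σ) (x.eval h σ)

/-- Number of elementary operations in a real expression; an oracle call is one of them. -/
def RealExpr.cost : RealExpr → ℕ
  | lit _ => 1
  | get _ _ i => 1 + ∑ j, (i j).cost
  | add x₁ x₂ => 1 + x₁.cost + x₂.cost
  | sub x₁ x₂ => 1 + x₁.cost + x₂.cost
  | mul x₁ x₂ => 1 + x₁.cost + x₂.cost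
  | oracle e x => 1 + e.cost + x.cost

/-- Tests. -/
inductive Test where
  | natLE (e₁ e₂ : NatExpr)
  | realLE (x₁ x₂ : RealExpr)
  | not (b : Test)
  | and (b₁ b₂ : Test)

/-- Truth of a test. -/
def Test.Holds (h : ℕ → ℝ → ℝ) (σ : State) : Test → Prop
  | natLE e₁ e₂ => e₁.eval σ ≤ e₂.eval σ
  | realLE x₁ x₂ => x₁.eval h σ ≤ x₂.eval h σ
  | not b => ¬ b.Holds h σ
  | and b₁ b₂ => b₁.Holds h σ ∧ b₂.Holds h σ

/-- Number of elementary operations in a test. -/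
def Test.cost : Test → ℕ
  | natLE e₁ e₂ => 1 + e₁.cost + e₂.cost
  | realLE x₁ x₂ => 1 + x₁.cost + x₂.cost
  | not b => 1 + b.cost
  | and b₁ b₂ => 1 + b₁.cost + b₂.cost

/-- Programs; `setNat a k i e` and `setReal a k i x` are assignments to the cell of the array `a`
at the `k`-tuple `i`. -/
inductive Program where
  | skip
  | setNat (a k : ℕ) (i : Fin k → NatExpr) (e : NatExpr)
  | setReal (a k : ℕ) (i : Fin k → NatExpr) (x : RealExpr)
  | seq (P Q : Program)
  | ite (b : Test) (P Q : Program)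
  | loop (b : Test) (P : Program)

/-- `Exec h W P σ σ' t`: with the oracle `h`, the program `P` started in the memory `σ` halts
in the memory `σ'` after `t` elementary operations.  Memory words hold natural numbers below `W`:
an assignment of a larger natural number gets stuck. -/
inductive Exec (h : ℕ → ℝ → ℝ) (W : ℕ) : Program → State → State → ℕ → Prop
  | skip (σ : State) : Exec h W .skip σ σ 1
  | setNat (a k : ℕ) (i : Fin k → NatExpr) (e : NatExpr) (σ : State) (hW : e.eval σ < W) :
      Exec h W (.setNat a k i e) σ
        (σ.setNat a (List.ofFn fun j => (i j).eval σ) (e.eval σ))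
        (1 + ∑ j, (i j).cost + e.cost)
  | setReal (a k : ℕ) (i : Fin k → NatExpr) (x : RealExpr) (σ : State) :
      Exec h W (.setReal a k i x) σ
        (σ.setReal a (List.ofFn fun j => (i j).eval σ) (x.eval h σ))
        (1 + ∑ j, (i j).cost + x.cost)
  | seq {P Q : Program} {σ₁ σ₂ σ₃ : State} {t₁ t₂ : ℕ}
      (hP : Exec h W P σ₁ σ₂ t₁) (hQ : Exec h W Q σ₂ σ₃ t₂) :
      Exec h W (.seq P Q) σ₁ σ₃ (t₁ + t₂)
  | ite_true {b : Test} {P Q : Program} {σ σ' : State} {t : ℕ}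
      (hb : b.Holds h σ) (hP : Exec h W P σ σ' t) :
      Exec h W (.ite b P Q) σ σ' (b.cost + t)
  | ite_false {b : Test} {P Q : Program} {σ σ' : State} {t : ℕ}
      (hb : ¬ b.Holds h σ) (hQ : Exec h W Q σ σ' t) :
      Exec h W (.ite b P Q) σ σ' (b.cost + t)
  | loop_true {b : Test} {P : Program} {σ₁ σ₂ σ₃ : State} {t₁ t₂ : ℕ}
      (hb : b.Holds h σ₁) (hP : Exec h W P σ₁ σ₂ t₁) (hL : Exec h W (.loop b P) σ₂ σ₃ t₂) :
      Exec h W (.loop b P) σ₁ σ₃ (b.cost + t₁ + t₂)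
  | loop_false {b : Test} {P : Program} {σ : State} (hb : ¬ b.Holds h σ) :
      Exec h W (.loop b P) σ σ b.cost

/-! ## Input and output of lot-sizing programs -/

namespace Instance

variable {m T : ℕ}

/-- The oracle for the inventory cost functions. -/
noncomputable def oracle (I : Instance m T) (j : ℕ) (x : ℝ) : ℝ :=
  if hj : j < T then I.H ⟨j, hj⟩ x else 0

/-- The input: natural scalar `0` holds `T`; the real arrays `0`, `1`, `2`, `3` hold the demands,
the breakpoints, the setup costs and the unit costs; every other cell is `0`. -/
noncomputable def input (I : Instance m T) : State where
  nat := fun a i => if a = 0 ∧ i = [] then T else 0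
  real := fun a i => match a, i with
    | 0, [j] => if hj : j < T then I.d ⟨j, hj⟩ else 0
    | 1, [l] => if hl : l < m then I.B ⟨l, hl⟩ else 0
    | 2, [j, l] => if hj : j < T ∧ l < m + 1 then I.s ⟨j, hj.1⟩ ⟨l, hj.2⟩ else 0
    | 3, [j, l] => if hj : j < T ∧ l < m + 1 then I.p ⟨j, hj.1⟩ ⟨l, hj.2⟩ else 0
    | _, _ => 0

end Instance

/-- The output: the entry with index `u` of the real array `4`. -/
def State.output (σ : State) (u : ℕ) : ℝ := σ.real 4 [u]

end LotSizing

set_option linter.unusedSimpArgs false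

namespace LotSizing

namespace Instance

variable {m T : ℕ} (I : Instance m T)

/-! ## The lot-sizing problem in terms of cumulative production -/

/-! Describe a plan by its cumulative production `L`, and let `D` be cumulative demand. A plan from
period `u` becomes a nondecreasing path from `D u` to `D T`. Production costs depend on the
increments of `L`, inventory costs on `L - D`. Each of these terms is concave between its knots,
which are `0` and the breakpoints for production and `0` for inventory. At the ends of a piece this
uses lower semicontinuity: there the production cost is at most the affine function of the piece
(`cost_le_line`, `cost_concave`).

Structure of optimal paths: call an index anchored if periods with production at a knot join it to
an index without inventory. If some index is not anchored, shift all unanchored levels by a common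
`ε`. Terms at a knot do not move, the others move at speed `0`, `1` or `-1`. By concavity, one of
the two nearest values of `ε` that bring a further term to a knot does not raise the cost
(`exists_critical_move`, `exists_tighter_path`). Only finitely many terms exist, so iteration ends
with all indices anchored. Hence paths through the levels `D v + ∑ n i * B i` with `v ≤ T` and `|n
i| ≤ T` suffice (`exists_path_in_levels`). There are `O(T ^ (m + 1))` such levels, and the set does
not depend on `u`, so one backward recursion serves all `u`.

Recursion: trying all pairs of levels in each period would be too slow. For a fixed period and
piece, the cost of moving from `a r` to `a i` is `s + p * (a i - a r)`, so one has to minimise `f i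
+ p * a i` over those `i` for which `a i - a r` lies in the piece. On a sorted list of levels this
is a sliding window minimum, and a monotone queue yields all of them in linear time
(`reaches_windowProg`). Windows are closed; the superfluous ends are harmless because the affine
function is never below the true cost there. With `m + 1` pieces and `T` periods this is `O(T ^ (m +
2))`. The list is built already sorted, by merging `2 * T` shifted copies of a sorted row for each
breakpoint (`reaches_roundProg`), so no logarithmic factor arises.

`IsPathValue` sandwiches a computed value: some path costs at most this much, and no path on the
grid costs less. The structure theorem turns this into an attained minimum over all plans
(`isCostToGo_of_isPathValue`).

Running time: `Reaches` counts loop iterations only, since time is at most the program size times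
the number of iterations plus one, and the program depends on `m` alone. -/

/-- Demand of period `j`, `0` from period `T` on. -/
noncomputable def demand (j : ℕ) : ℝ := I.input.real 0 [j]

/-- Breakpoint number `l`, `0` for `m ≤ l`. -/
noncomputable def bp (l : ℕ) : ℝ := I.input.real 1 [l]

/-- The affine function of piece `l` in period `j`. -/
noncomputable def line (j l : ℕ) (x : ℝ) : ℝ := I.input.real 2 [j, l] + I.input.real 3 [j, l] * x

/-- Production cost with periods indexed by natural numbers. -/
noncomputable def cost (j : ℕ) (x : ℝ) : ℝ := if h : j < T then I.prodCost ⟨j, h⟩ x else 0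

/-- Total demand of the periods before `j`. -/
noncomputable def cumDemand (j : ℕ) : ℝ := ∑ i ∈ Finset.range j, I.demand i

/-- The quantities at which production costs change their piece. -/
noncomputable def knots : Finset ℝ := insert 0 ((Finset.range m).image I.bp)

/-- Cost of the periods `u, …, T - 1` if `L j` is the cumulative production before period `j`. -/
noncomputable def pathCost (u : ℕ) (L : ℕ → ℝ) : ℝ :=
  ∑ j ∈ Finset.Ico u T, (I.cost j (L (j + 1) - L j) + I.oracle j (L (j + 1) - I.cumDemand (j + 1)))

/-- `L` is a feasible cumulative production from level `q` at the start of period `u` on. -/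
structure IsPath (u : ℕ) (q : ℝ) (L : ℕ → ℝ) : Prop where
  start : L u = q
  finish : L T = I.cumDemand T
  mono : ∀ j, u ≤ j → j < T → L j ≤ L (j + 1)

theorem demand_nonneg (j : ℕ) : 0 ≤ I.demand j := by
  simp only [demand, input]
  split_ifs with h
  · exact I.d_nonneg _
  · exact le_rfl

theorem bp_eq {l : ℕ} (hl : l < m) : I.bp l = I.B ⟨l, hl⟩ := by
  simp [bp, input, hl]

theorem line_eq {j l : ℕ} (hj : j < T) (hl : l < m + 1) (x : ℝ) :
    I.line j l x = I.s ⟨j, hj⟩ ⟨l, hl⟩ + I.p ⟨j, hj⟩ ⟨l, hl⟩ * x := by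
  simp [line, input, hj, Nat.lt_succ_iff.mp hl]

theorem bp_pos {l : ℕ} (hl : l < m) : 0 < I.bp l := by
  rw [bp_eq I hl]; exact I.B_pos _

theorem bp_lt {k l : ℕ} (hkl : k < l) (hl : l < m) : I.bp k < I.bp l := by
  rw [bp_eq I hl, bp_eq I (hkl.trans hl)]
  exact I.B_strictMono hkl

theorem bp_le {k l : ℕ} (hkl : k ≤ l) (hl : l < m) : I.bp k ≤ I.bp l := by
  rcases hkl.eq_or_lt with rfl | h
  · exact le_rfl
  · exact (I.bp_lt h hl).le

theorem cumDemand_succ (j : ℕ) : I.cumDemand (j + 1) = I.cumDemand j + I.demand j :=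
  Finset.sum_range_succ _ _

theorem cumDemand_mono : Monotone I.cumDemand :=
  monotone_nat_of_le_succ fun j => by
    rw [cumDemand_succ]; linarith [I.demand_nonneg j]

theorem cost_zero (j : ℕ) : I.cost j 0 = 0 := by
  simp [cost, prodCost]

theorem oracle_zero (j : ℕ) : I.oracle j 0 = 0 := by
  unfold oracle
  split_ifs with h
  · exact I.H_zero _
  · rfl

theorem piece_eq {x : ℝ} {l : ℕ} (hl : l < m + 1) (h₁ : ∀ i < l, I.bp i < x)
    (h₂ : ∀ i, l ≤ i → i < m → x ≤ I.bp i) : I.piece x = ⟨l, hl⟩ := by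
  classical
  apply Fin.ext
  have : (Finset.univ.filter fun i : Fin m => I.B i < x) =
      Finset.univ.filter fun i : Fin m => (i : ℕ) < l := by
    ext i
    simp only [Finset.mem_filter, Finset.mem_univ, true_and]
    constructor
    · intro h
      by_contra hi
      have := h₂ i (not_lt.mp hi) i.2
      rw [bp_eq I i.2] at this
      exact absurd h (not_lt.mpr this)
    · intro h
      have := h₁ i h
      rwa [bp_eq I i.2] at this
  simp only [piece]
  rw [Finset.filter_congr_decidable, this, Fin.card_filter_val_lt]
  omega

theorem cost_eq_line {j l : ℕ} (hj : j < T) (hl : l ≤ m) {x : ℝ} (hx : 0 < x)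
    (h₁ : ∀ i < l, I.bp i < x) (h₂ : ∀ i, l ≤ i → i < m → x ≤ I.bp i) :
    I.cost j x = I.line j l x := by
  have hl' : l < m + 1 := by omega
  rw [line_eq I hj hl', cost, dif_pos hj, prodCost, if_neg hx.ne', piece_eq I hl' h₁ h₂]

/-- Every positive quantity belongs to a piece. -/
theorem exists_piece (x : ℝ) :
    ∃ l ≤ m, (∀ i < l, I.bp i < x) ∧ ∀ i, l ≤ i → i < m → x ≤ I.bp i := by
  classical
  by_cases h : ∃ l, l < m ∧ x ≤ I.bp l
  · refine ⟨Nat.find h, (Nat.find_spec h).1.le, fun i hi => ?_, fun i hi him =>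
      (Nat.find_spec h).2.trans (I.bp_le hi him)⟩
    have := Nat.find_min h hi
    push Not at this
    exact this (hi.trans (Nat.find_spec h).1)
  · push Not at h
    exact ⟨m, le_rfl, h, fun i hi him => absurd him (not_lt.mpr hi)⟩

/-- On the half-open piece the two sides agree, so only the lower end (including `0`) matters, and
there lower semicontinuity excludes an upward jump. This is what allows closed pieces both in the
exchange argument and in the algorithm. -/
theorem cost_le_line (hlsc : ∀ j, LowerSemicontinuousOn (I.prodCost j) (Set.Ici 0)) {j l : ℕ} (hj : j < T) (hl : l ≤ m) {x : ℝ} (hx : 0 ≤ x)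
    (h₁ : ∀ i < l, I.bp i ≤ x) (h₂ : ∀ i, l ≤ i → i < m → x ≤ I.bp i) :
    I.cost j x ≤ I.line j l x := by
  -- Below the upper end the piece continues to the right of `x`. If the cost at `x` exceeded the
  -- line, it would stay above some `y` nearby, whereas just right of `x` it equals the line, which
  -- is below `y`.
  by_cases hs : l < m → x < I.bp l
  · have hup : ∃ b, x < b ∧ ∀ i, l ≤ i → i < m → b ≤ I.bp i := by
      by_cases hlm : l < m
      · exact ⟨I.bp l, hs hlm, fun i hi him => I.bp_le hi him⟩
      · exact ⟨x + 1, by linarith, fun i hi him => absurd him (by omega)⟩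
    obtain ⟨b, hxb, hb⟩ := hup
    by_contra hlt
    push Not at hlt
    obtain ⟨y, hy₁, hy₂⟩ := exists_between hlt
    rw [cost, dif_pos hj] at hy₂
    have e₁ := hlsc ⟨j, hj⟩ x hx y hy₂
    have e₁' := e₁.filter_mono (nhdsWithin_mono x (Set.Ioi_subset_Ici hx))
    have hc : Continuous (I.line j l) := by unfold line; fun_prop
    have e₂ : ∀ᶠ z in nhdsWithin x (Set.Ioi x), I.line j l z < y :=
      (hc.continuousAt.eventually_lt_const hy₁).filter_mono nhdsWithin_le_nhds
    have e₃ : ∀ᶠ z in nhdsWithin x (Set.Ioi x), z ∈ Set.Ioo x b := Ioo_mem_nhdsGT hxb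
    obtain ⟨z, hz₁, hz₂, hz₃⟩ := (e₁'.and (e₂.and e₃)).exists
    have := I.cost_eq_line hj hl (x := z) (hx.trans_lt hz₃.1)
      (fun i hi => (h₁ i hi).trans_lt hz₃.1) (fun i hi him => hz₃.2.le.trans (hb i hi him))
    rw [cost, dif_pos hj] at this
    linarith
  · push Not at hs
    have hxl : x = I.bp l := le_antisymm (h₂ l le_rfl hs.1) hs.2
    refine (I.cost_eq_line hj hl ?_ (fun i hi => ?_) h₂).le
    · rw [hxl]; exact I.bp_pos hs.1
    · rw [hxl]; exact I.bp_lt hi hs.1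

/-- With no knot strictly between `lo` and `hi`, both ends lie in the closed piece of `x`. The cost
is at most the line at the ends and equal to it at `x`. -/
theorem cost_concave (hlsc : ∀ j, LowerSemicontinuousOn (I.prodCost j) (Set.Ici 0)) {j : ℕ} (hj : j < T) {lo hi x α β : ℝ} (hlx : lo < x) (hxh : x < hi)
    (hx : 0 ≤ x) (hxk : x ∉ I.knots) (hk : ∀ k ∈ I.knots, ¬ (lo < k ∧ k < hi)) (hα : 0 ≤ α)
    (hβ : 0 ≤ β) (hαβ : α + β = 1) (he : α * lo + β * hi = x) :
    α * I.cost j lo + β * I.cost j hi ≤ I.cost j x := by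
  have hk0 : (0 : ℝ) ∈ I.knots := Finset.mem_insert_self _ _
  have hkb : ∀ i < m, I.bp i ∈ I.knots := fun i hi =>
    Finset.mem_insert_of_mem (Finset.mem_image_of_mem _ (Finset.mem_range.mpr hi))
  have hx0 : 0 < x := lt_of_le_of_ne hx fun h => hxk (h ▸ hk0)
  have hlo : 0 ≤ lo := by
    by_contra h
    exact hk 0 hk0 ⟨not_le.mp h, hx0.trans hxh⟩
  obtain ⟨l, hl, h₁, h₂⟩ := I.exists_piece x
  have h₁' : ∀ i < l, I.bp i ≤ lo := fun i hi' => by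
    by_contra h
    exact hk _ (hkb i (by omega)) ⟨not_le.mp h, (h₁ i hi').trans hxh⟩
  have h₂' : ∀ i, l ≤ i → i < m → hi ≤ I.bp i := fun i hi' him => by
    by_contra h
    exact hk _ (hkb i him) ⟨hlx.trans_le (h₂ i hi' him), not_le.mp h⟩
  have c₁ := I.cost_le_line hlsc hj hl hlo h₁' fun i a b =>
    (hlx.trans hxh).le.trans (h₂' i a b)
  have c₂ := I.cost_le_line hlsc hj hl (hlo.trans (hlx.trans hxh).le)
    (fun i a => ((h₁ i a).trans hxh).le) h₂'
  rw [I.cost_eq_line hj hl hx0 h₁ h₂]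
  have e : I.line j l x = α * I.line j l lo + β * I.line j l hi := by
    simp only [line]
    rw [← he]
    linear_combination (-(I.input.real 2 [j, l])) * hαβ
  rw [e]
  gcongr

/-- The interval lies on one side of `0`, where the inventory cost is concave. -/
theorem oracle_concave (j : ℕ) {lo hi x α β : ℝ} (hlx : lo < x) (hxh : x < hi)
    (hk : ¬ (lo < 0 ∧ 0 < hi)) (hα : 0 ≤ α) (hβ : 0 ≤ β) (hαβ : α + β = 1)
    (he : α * lo + β * hi = x) :
    α * I.oracle j lo + β * I.oracle j hi ≤ I.oracle j x := by
  unfold oracle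
  split_ifs with hj
  · rw [← he]
    by_cases h : 0 ≤ lo
    · exact (I.H_concave_stock ⟨j, hj⟩).2 h (h.trans (hlx.trans hxh).le) hα hβ hαβ
    · have h' : hi ≤ 0 := not_lt.mp fun h' => hk ⟨not_le.mp h, h'⟩
      exact (I.H_concave_backlog ⟨j, hj⟩).2 (not_le.mp h).le h' hα hβ hαβ
  · simp

end Instance

/-! ### Exchange along a line for piecewise concave sums -/

/-- Moving a point along a line to one of the two next critical positions does not increase a sum
of functions that are concave between their knots. -/
theorem exists_critical_move {ι : Type*} [DecidableEq ι] (s : Finset ι) (v c : ι → ℝ)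
    (K : ι → Finset ℝ) (φ : ι → ℝ → ℝ)
    (hc : ∀ i ∈ s, c i = 0 ∨ c i = 1 ∨ c i = -1)
    (hv : ∀ i ∈ s, c i ≠ 0 → v i ∉ K i)
    (hφ : ∀ i ∈ s, c i ≠ 0 → ∀ lo hi α β, lo < v i → v i < hi →
      (∀ k ∈ K i, ¬ (lo < k ∧ k < hi)) → 0 ≤ α → 0 ≤ β → α + β = 1 → α * lo + β * hi = v i →
      α * φ i lo + β * φ i hi ≤ φ i (v i))
    (hpos : ∃ i ∈ s, c i ≠ 0 ∧ ∃ k ∈ K i, 0 < (k - v i) * c i)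
    (hneg : ∃ i ∈ s, c i ≠ 0 ∧ ∃ k ∈ K i, (k - v i) * c i < 0) :
    ∃ ε, ∑ i ∈ s, φ i (v i + c i * ε) ≤ ∑ i ∈ s, φ i (v i) ∧
      (∀ i ∈ s, ∀ k ∈ K i, k < v i → c i ≠ 0 → k ≤ v i + c i * ε) ∧
      ∃ i ∈ s, c i ≠ 0 ∧ v i + c i * ε ∈ K i := by
  classical
  -- Since `c i = ±1`, the parameter that moves term `i` to the knot `k` is `(k - v i) / c i = (k -
  -- v i) * c i`.
  let C : Finset ℝ := (s.filter fun i => c i ≠ 0).biUnion fun i => (K i).image fun k => (k - v i) * c i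
  have hC : ∀ e, e ∈ C ↔ ∃ i ∈ s, c i ≠ 0 ∧ ∃ k ∈ K i, (k - v i) * c i = e := by
    intro e
    simp only [C, Finset.mem_biUnion, Finset.mem_filter, Finset.mem_image, and_assoc]
  have hPne : (C.filter (0 < ·)).Nonempty := by
    obtain ⟨i, hi, hci, k, hk, h⟩ := hpos
    exact ⟨_, Finset.mem_filter.mpr ⟨(hC _).mpr ⟨i, hi, hci, k, hk, rfl⟩, h⟩⟩
  have hNne : (C.filter (· < 0)).Nonempty := by
    obtain ⟨i, hi, hci, k, hk, h⟩ := hneg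
    exact ⟨_, Finset.mem_filter.mpr ⟨(hC _).mpr ⟨i, hi, hci, k, hk, rfl⟩, h⟩⟩
  obtain ⟨p, hp⟩ : ∃ p, p = (C.filter (0 < ·)).min' hPne := ⟨_, rfl⟩
  obtain ⟨n, hn⟩ : ∃ n, n = (C.filter (· < 0)).max' hNne := ⟨_, rfl⟩
  have hpm := Finset.mem_filter.mp (hp ▸ Finset.min'_mem _ hPne)
  have hnm := Finset.mem_filter.mp (hn ▸ Finset.max'_mem _ hNne)
  have hple : ∀ e ∈ C, 0 < e → p ≤ e := fun e he h =>
    hp ▸ Finset.min'_le _ _ (Finset.mem_filter.mpr ⟨he, h⟩)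
  have hnle : ∀ e ∈ C, e < 0 → e ≤ n := fun e he h =>
    hn ▸ Finset.le_max' _ _ (Finset.mem_filter.mpr ⟨he, h⟩)
  have hp0 := hpm.2
  have hn0 := hnm.2
  have key : ∀ i ∈ s, c i ≠ 0 → ∀ k ∈ K i, (k - v i) * c i ≤ n ∨ p ≤ (k - v i) * c i := by
    intro i hi hci k hk
    have hmem := (hC _).mpr ⟨i, hi, hci, k, hk, rfl⟩
    rcases lt_trichotomy ((k - v i) * c i) 0 with h | h | h
    · exact Or.inl (hnle _ hmem h)
    · exfalso
      rcases mul_eq_zero.mp h with h | h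
      · exact hv i hi hci (by rwa [show v i = k by linarith])
      · exact hci h
    · exact Or.inr (hple _ hmem h)
  have hlow : ∀ ε, (ε = p ∨ ε = n) → ∀ i ∈ s, ∀ k ∈ K i, k < v i → c i ≠ 0 →
      k ≤ v i + c i * ε := by
    intro ε hε i hi k hk hkv hci
    have h1 := key i hi hci k hk
    rcases (hc i hi).resolve_left hci with h | h <;> rw [h] at h1 ⊢ <;>
      rcases h1 with h1 | h1 <;> rcases hε with rfl | rfl <;> linarith
  have htight : ∀ ε ∈ C, ∃ i ∈ s, c i ≠ 0 ∧ v i + c i * ε ∈ K i := by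
    intro ε hε
    obtain ⟨i, hi, hci, k, hk, rfl⟩ := (hC _).mp hε
    refine ⟨i, hi, hci, ?_⟩
    have : v i + c i * ((k - v i) * c i) = k := by
      rcases (hc i hi).resolve_left hci with h | h <;> rw [h] <;> ring
    rwa [this]
  -- Weights for which `0` is the convex combination `α * n + β * p`. The weighted mean of the sums
  -- at `n` and `p` is at most the present sum, so one of the two is.
  set α := p / (p - n)
  set β := -n / (p - n)
  have hd : 0 < p - n := by linarith
  have hα : 0 ≤ α := div_nonneg hp0.le hd.le
  have hβ : 0 ≤ β := div_nonneg (by linarith) hd.le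
  have hαβ : α + β = 1 := by simp only [α, β]; field_simp; ring
  have hz : α * n + β * p = 0 := by simp only [α, β]; field_simp; ring
  have hsum : α * ∑ i ∈ s, φ i (v i + c i * n) + β * ∑ i ∈ s, φ i (v i + c i * p) ≤
      ∑ i ∈ s, φ i (v i) := by
    rw [Finset.mul_sum, Finset.mul_sum, ← Finset.sum_add_distrib]
    refine Finset.sum_le_sum fun i hi => ?_
    by_cases hci : c i = 0
    · simp only [hci, zero_mul, add_zero]
      rw [← add_mul, hαβ, one_mul]
    · rcases (hc i hi).resolve_left hci with h | h
      · refine hφ i hi hci _ _ α β (by rw [h]; linarith) (by rw [h]; linarith) (fun k hk hlt => ?_)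
          hα hβ hαβ (by linear_combination v i * hαβ + c i * hz)
        have := key i hi hci k hk
        rw [h] at this hlt
        rcases this with h' | h' <;> linarith [hlt.1, hlt.2]
      -- For `c i = -1` the parameter `p` gives the lower end and `n` the upper one, so the weights
      -- change places.
      · rw [add_comm]
        refine hφ i hi hci _ _ β α (by rw [h]; linarith) (by rw [h]; linarith) (fun k hk hlt => ?_)
          hβ hα (by linarith) (by linear_combination v i * hαβ + c i * hz)
        have := key i hi hci k hk
        rw [h] at this hlt
        rcases this with h' | h' <;> linarith [hlt.1, hlt.2]
  by_cases hcase : ∑ i ∈ s, φ i (v i + c i * n) ≤ ∑ i ∈ s, φ i (v i)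
  · exact ⟨n, hcase, hlow n (Or.inr rfl), htight n hnm.1⟩
  · refine ⟨p, ?_, hlow p (Or.inl rfl), htight p hpm.1⟩
    by_contra h
    push Not at h hcase
    have hα' : 0 < α := div_pos hp0 hd
    have : α * ∑ i ∈ s, φ i (v i) + β * ∑ i ∈ s, φ i (v i) <
        α * ∑ i ∈ s, φ i (v i + c i * n) + β * ∑ i ∈ s, φ i (v i + c i * p) :=
      add_lt_add_of_lt_of_le (mul_lt_mul_of_pos_left hcase hα')
        (mul_le_mul_of_nonneg_left h.le hβ)
    rw [← add_mul, hαβ, one_mul] at this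
    linarith


/-! ### Levels that suffice for optimal paths -/

namespace Instance

variable {m T : ℕ} (I : Instance m T)

/-- The levels `D v + ∑ i < c, n i * B i` with `v ≤ T` and integers `|n i| ≤ T`, where `D` is the
cumulative demand. -/
noncomputable def levels : ℕ → Set ℝ
  | 0 => {z | ∃ v ≤ T, z = I.cumDemand v}
  | c + 1 => {z | ∃ y ∈ levels c, ∃ n : ℤ, |n| ≤ T ∧ z = y + n * I.bp c}

theorem mem_levels {v : ℕ} (hv : v ≤ T) (n : ℕ → ℤ) (hn : ∀ i, |n i| ≤ T) (c : ℕ) :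
    I.cumDemand v + ∑ i ∈ Finset.range c, n i * I.bp i ∈ I.levels c := by
  induction c with
  | zero => exact ⟨v, hv, by simp⟩
  | succ c ih => exact ⟨_, ih, n c, hn c, by rw [Finset.sum_range_succ]; ring⟩

/-- Along periods that produce nothing or a breakpoint, the level changes by a combination of
breakpoints. -/
theorem exists_combination (L : ℕ → ℝ) (a k : ℕ)
    (h : ∀ i, a ≤ i → i < a + k → L (i + 1) - L i ∈ I.knots) :
    ∃ n : ℕ → ℤ, (∀ i, |n i| ≤ k) ∧
      L (a + k) = L a + ∑ i ∈ Finset.range m, n i * I.bp i := by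
  induction k with
  | zero => exact ⟨0, by simp, by simp⟩
  | succ k ih =>
    obtain ⟨n, hn, hL⟩ := ih fun i h₁ h₂ => h i h₁ (by omega)
    have hk := h (a + k) (by omega) (by omega)
    simp only [knots, Finset.mem_insert, Finset.mem_image, Finset.mem_range] at hk
    rcases hk with hk | ⟨l, hl, hk⟩
    · refine ⟨n, fun i => (hn i).trans (by push_cast; linarith), ?_⟩
      rw [← hL, ← add_assoc]; linarith
    · refine ⟨fun i => n i + if i = l then 1 else 0, fun i => ?_, ?_⟩
      · refine (abs_add_le _ _).trans ?_
        push_cast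
        refine add_le_add (hn i) ?_
        split_ifs <;> simp
      · have : ∑ i ∈ Finset.range m, ((n i + if i = l then 1 else 0 : ℤ) : ℝ) * I.bp i =
            ∑ i ∈ Finset.range m, n i * I.bp i + I.bp l := by
          simp only [Int.cast_add, add_mul, Finset.sum_add_distrib]
          congr 1
          simp [hl]
        rw [this, ← add_assoc]
        linarith

/-- Index `j` is joined to an index without inventory by periods that produce nothing or a
breakpoint. -/
def Anchored (u : ℕ) (L : ℕ → ℝ) (j : ℕ) : Prop :=
  ∃ v, u ≤ v ∧ v ≤ T ∧ L v = I.cumDemand v ∧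
    ∀ k, min v j ≤ k → k < max v j → L (k + 1) - L k ∈ I.knots

/-- Add up the productions between the anchor `v` and `j`. If the anchor is later than `j` they are
subtracted, which is why negative coefficients are needed; at most `T` periods are involved, which
bounds them. -/
theorem Anchored.mem_levels {I : Instance m T} {u : ℕ} {L : ℕ → ℝ} {j : ℕ} (hjT : j ≤ T)
    (h : I.Anchored u L j) : L j ∈ I.levels m := by
  obtain ⟨v, huv, hvT, hv, hl⟩ := h
  rcases le_total v j with hvj | hvj
  · obtain ⟨n, hn, hL⟩ := I.exists_combination L v (j - v) fun i h₁ h₂ =>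
      hl i (by omega) (by omega)
    rw [show v + (j - v) = j by omega] at hL
    rw [hL, hv]
    exact I.mem_levels hvT n (fun i => (hn i).trans (by exact_mod_cast (by omega))) m
  · obtain ⟨n, hn, hL⟩ := I.exists_combination L j (v - j) fun i h₁ h₂ =>
      hl i (by omega) (by omega)
    rw [show j + (v - j) = v by omega] at hL
    have : L j = I.cumDemand v + ∑ i ∈ Finset.range m, ((-n i : ℤ) : ℝ) * I.bp i := by
      simp only [Int.cast_neg, neg_mul, Finset.sum_neg_distrib]
      linarith
    rw [this]
    refine I.mem_levels hvT (fun i => -n i) (fun i => ?_) m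
    rw [abs_neg]
    exact (hn i).trans (by exact_mod_cast (by omega))

/-- The chain to the anchor can be prolonged or shortened by this link. So a period that separates
anchored from unanchored indices produces a quantity off the knots. -/
theorem Anchored.of_link {I : Instance m T} {u : ℕ} {L : ℕ → ℝ} {j : ℕ}
    (hl : L (j + 1) - L j ∈ I.knots) : I.Anchored u L j ↔ I.Anchored u L (j + 1) := by
  constructor
  · rintro ⟨v, huv, hvT, hv, h⟩
    refine ⟨v, huv, hvT, hv, fun k h₁ h₂ => ?_⟩
    by_cases hk : k = j
    · exact hk ▸ hl
    · exact h k (by omega) (by omega)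
  · rintro ⟨v, huv, hvT, hv, h⟩
    refine ⟨v, huv, hvT, hv, fun k h₁ h₂ => ?_⟩
    by_cases hk : k = j
    · exact hk ▸ hl
    · exact h k (by omega) (by omega)

theorem Anchored.of_eq {I : Instance m T} {u : ℕ} {L : ℕ → ℝ} {j : ℕ} (huj : u ≤ j) (hjT : j ≤ T)
    (h : L j = I.cumDemand j) : I.Anchored u L j :=
  ⟨j, huj, hjT, h, fun k h₁ h₂ => by omega⟩

/-- The terms of the cost of a path: production (`true`) and inventory (`false`). -/
noncomputable def termVal (L : ℕ → ℝ) (i : ℕ × Bool) : ℝ :=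
  if i.2 then L (i.1 + 1) - L i.1 else L (i.1 + 1) - I.cumDemand (i.1 + 1)

/-- Knots of the terms of the cost of a path. -/
noncomputable def termKnots (i : ℕ × Bool) : Finset ℝ := if i.2 then I.knots else {0}

theorem pathCost_eq_sum (u : ℕ) (L : ℕ → ℝ) :
    I.pathCost u L = ∑ i ∈ Finset.Ico u T ×ˢ (Finset.univ : Finset Bool),
      (if i.2 then I.cost i.1 else I.oracle i.1) (I.termVal L i) := by
  rw [Finset.sum_product]
  simp [pathCost, termVal]

open Classical in
/-- The number of terms of the cost of a path that sit at a knot. -/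
noncomputable def tightCount (u : ℕ) (L : ℕ → ℝ) : ℕ :=
  ((Finset.Ico u T ×ˢ (Finset.univ : Finset Bool)).filter
    fun i => I.termVal L i ∈ I.termKnots i).card

theorem exists_tighter_path (hlsc : ∀ j, LowerSemicontinuousOn (I.prodCost j) (Set.Ici 0))
    {u : ℕ} {L : ℕ → ℝ} (hL : I.IsPath u (I.cumDemand u) L) {b : ℕ} (hub : u ≤ b) (hbT : b ≤ T)
    (hb : ¬ I.Anchored u L b) :
    ∃ L', I.IsPath u (I.cumDemand u) L' ∧ I.pathCost u L' ≤ I.pathCost u L ∧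
      I.tightCount u L < I.tightCount u L' := by
  classical
  set s : Finset (ℕ × Bool) := Finset.Ico u T ×ˢ (Finset.univ : Finset Bool) with hs
  -- `e` is the direction of the shift of `L`, and `c` the resulting speed of each cost term.
  let e : ℕ → ℝ := fun j => if I.Anchored u L j then 0 else 1
  let c : ℕ × Bool → ℝ := fun i => if i.2 then e (i.1 + 1) - e i.1 else e (i.1 + 1)
  have hms : ∀ i, i ∈ s ↔ u ≤ i.1 ∧ i.1 < T := by intro i; simp [hs]
  have hau : I.Anchored u L u := .of_eq le_rfl (hub.trans hbT) hL.start
  have haT : I.Anchored u L T := .of_eq (hub.trans hbT) le_rfl hL.finish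
  have htight : ∀ i ∈ s, I.termVal L i ∈ I.termKnots i → c i = 0 := by
    rintro ⟨j, t⟩ hi hk
    have hj := (hms _).mp hi
    cases t
    · simp only [termVal, termKnots, Finset.mem_singleton, Bool.false_eq_true, if_false] at hk
      have : I.Anchored u L (j + 1) := .of_eq (by simp at hj; omega) hj.2 (by linarith)
      simp [c, e, this]
    · simp only [termVal, termKnots, if_true] at hk
      have := Anchored.of_link (u := u) hk
      simp [c, e, this]
  have hx0 : ∀ j, u ≤ j → j < T → L (j + 1) - L j ∉ I.knots → 0 < L (j + 1) - L j := by
    intro j h₁ h₂ h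
    refine lt_of_le_of_ne (sub_nonneg.mpr (hL.mono j h₁ h₂)) fun h0 => h ?_
    rw [← h0]
    exact Finset.mem_insert_self _ _
  have hsw : ∀ j, u ≤ j → j < T → ¬ (I.Anchored u L j ↔ I.Anchored u L (j + 1)) →
      0 < L (j + 1) - L j := fun j h₁ h₂ h =>
    hx0 j h₁ h₂ fun hk => h (Anchored.of_link hk)
  have hzero : (0 : ℝ) ∈ I.knots := Finset.mem_insert_self _ _
  -- Both ends are anchored and `b` is not, so a maximal unanchored stretch is entered in some
  -- period `p` and left in some period `q`. Production there is positive and has speed `1` and `-1`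
  -- respectively; its knot `0` bounds the shift in both directions.
  obtain ⟨p, hpu, hpT, hp₁, hp₂⟩ : ∃ j, u ≤ j ∧ j < T ∧ I.Anchored u L j ∧
      ¬ I.Anchored u L (j + 1) := by
    by_contra hcon
    push Not at hcon
    exact hb (Nat.le_induction (P := fun n _ => n ≤ T → I.Anchored u L n) (fun _ => hau)
      (fun n hn ih hnb => hcon n hn (by omega) (ih (by omega))) b hub hbT)
  obtain ⟨q, hqu, hqT, hq₁, hq₂⟩ : ∃ j, u ≤ j ∧ j < T ∧ ¬ I.Anchored u L j ∧
      I.Anchored u L (j + 1) := by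
    by_contra hcon
    push Not at hcon
    exact Nat.le_induction (P := fun n _ => n ≤ T → ¬ I.Anchored u L n) (fun _ => hb)
      (fun n hn ih hnb => hcon n (by omega) (by omega) (ih (by omega))) T hbT le_rfl haT
  obtain ⟨ε, hcost, hlow, i₀, hi₀, hci₀, hki₀⟩ := exists_critical_move s (I.termVal L) c I.termKnots
    (fun i => if i.2 then I.cost i.1 else I.oracle i.1)
    (by
      rintro ⟨j, t⟩ -
      cases t <;> simp only [c, e] <;> split_ifs <;> simp)
    (fun i hi hci hk => hci (htight i hi hk))
    (by
      rintro ⟨j, t⟩ hi hci lo hi' α β h₁ h₂ hk hα hβ hαβ he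
      have hj := (hms _).mp hi
      cases t
      · refine I.oracle_concave j h₁ h₂ (hk 0 (by simp [termKnots])) hα hβ hαβ he
      · have hv : I.termVal L (j, true) ∉ I.knots := fun h => hci (htight (j, true) hi h)
        exact I.cost_concave hlsc hj.2 h₁ h₂ (hx0 j hj.1 hj.2 hv).le hv hk hα hβ hαβ he)
    (by
      refine ⟨(q, true), (hms _).mpr ⟨hqu, hqT⟩, by simp [c, e, hq₁, hq₂], 0, hzero, ?_⟩
      have := hsw q hqu hqT (by tauto)
      simp only [termVal, c, e, hq₁, hq₂, if_true, if_false]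
      linarith)
    (by
      refine ⟨(p, true), (hms _).mpr ⟨hpu, hpT⟩, by simp [c, e, hp₁, hp₂], 0, hzero, ?_⟩
      have := hsw p hpu hpT (by tauto)
      simp only [termVal, c, e, hp₁, hp₂, if_true, if_false]
      linarith)
  set L' : ℕ → ℝ := fun j => L j + e j * ε with hL'
  have hval : ∀ i, I.termVal L' i = I.termVal L i + c i * ε := by
    rintro ⟨j, t⟩
    cases t
    · simp only [termVal, hL', c, Bool.false_eq_true, if_false]; ring
    · simp only [termVal, hL', c, if_true]; ring
  refine ⟨L', ⟨?_, ?_, fun j h₁ h₂ => ?_⟩, ?_, ?_⟩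
  · simp [hL', e, hau, hL.start]
  · simp [hL', e, haT, hL.finish]
  · have hv := hval (j, true)
    simp only [termVal, if_true] at hv
    by_cases hcj : c (j, true) = 0
    · rw [hcj] at hv
      linarith [hL.mono j h₁ h₂]
    · have hmem := (hms (j, true)).mpr ⟨h₁, h₂⟩
      have hpos := hx0 j h₁ h₂ fun h => hcj (htight (j, true) hmem h)
      -- The shift stops at the first critical position, so it does not carry a production past the
      -- knot `0`.
      have := hlow (j, true) hmem 0 hzero hpos hcj
      simp only [termVal, if_true] at this
      linarith
  · rw [pathCost_eq_sum, pathCost_eq_sum, ← hs]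
    simp only [hval]
    exact hcost
  · unfold tightCount
    rw [← hs]
    refine Finset.card_lt_card (Finset.ssubset_iff_of_subset ?_ |>.mpr ⟨i₀, ?_, ?_⟩)
    · intro i hi
      obtain ⟨h₁, h₂⟩ := Finset.mem_filter.mp hi
      refine Finset.mem_filter.mpr ⟨h₁, ?_⟩
      rw [hval, htight i h₁ h₂, zero_mul, add_zero]
      exact h₂
    · refine Finset.mem_filter.mpr ⟨hi₀, ?_⟩
      rw [hval]
      exact hki₀
    · intro h
      exact hci₀ (htight _ hi₀ (Finset.mem_filter.mp h).2)

/-- Some optimal path only visits the levels in `levels m`. -/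
theorem exists_path_in_levels (hlsc : ∀ j, LowerSemicontinuousOn (I.prodCost j) (Set.Ici 0))
    {u : ℕ} {L : ℕ → ℝ} (hL : I.IsPath u (I.cumDemand u) L) :
    ∃ L', I.IsPath u (I.cumDemand u) L' ∧ I.pathCost u L' ≤ I.pathCost u L ∧
      ∀ j, u ≤ j → j ≤ T → L' j ∈ I.levels m := by
  have hbound : ∀ L, I.tightCount u L ≤
      (Finset.Ico u T ×ˢ (Finset.univ : Finset Bool)).card := fun L => Finset.card_filter_le _ _
  -- Induction on the number of terms that are not at a knot.
  generalize hk : (Finset.Ico u T ×ˢ (Finset.univ : Finset Bool)).card - I.tightCount u L = k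
  induction k using Nat.strong_induction_on generalizing L with
  | _ k ih =>
    by_cases h : ∀ j, u ≤ j → j ≤ T → I.Anchored u L j
    · exact ⟨L, hL, le_rfl, fun j h₁ h₂ => (h j h₁ h₂).mem_levels h₂⟩
    · push Not at h
      obtain ⟨b, hub, hbT, hb⟩ := h
      obtain ⟨L₁, hL₁, hc₁, ht₁⟩ := I.exists_tighter_path hlsc hL hub hbT hb
      have := hbound L₁
      obtain ⟨L₂, hL₂, hc₂, hm₂⟩ := ih _ (by omega) hL₁ rfl
      exact ⟨L₂, hL₂, hc₂.trans hc₁, hm₂⟩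

/-! ### Backward recursion on a finite grid of levels -/

/-- `v` is the optimal cost of a path from level `q` in period `j`: it is attained up to
improvement, and no path through levels in `Z` is cheaper. -/
def IsPathValue (Z : Set ℝ) (j : ℕ) (q v : ℝ) : Prop :=
  (∃ L, I.IsPath j q L ∧ I.pathCost j L ≤ v) ∧
    ∀ L, I.IsPath j q L → (∀ i, j ≤ i → i ≤ T → L i ∈ Z) → v ≤ I.pathCost j L

theorem pathCost_succ {j : ℕ} (hj : j < T) (L : ℕ → ℝ) :
    I.pathCost j L = I.cost j (L (j + 1) - L j) + I.oracle j (L (j + 1) - I.cumDemand (j + 1)) +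
      I.pathCost (j + 1) L := by
  unfold pathCost
  rw [Finset.sum_eq_sum_Ico_succ_bot hj]

theorem IsPath.tail {I : Instance m T} {j : ℕ} {q : ℝ} {L : ℕ → ℝ} (h : I.IsPath j q L) :
    I.IsPath (j + 1) (L (j + 1)) L :=
  ⟨rfl, h.finish, fun i hi hT => h.mono i (by omega) hT⟩

theorem IsPath.le_finish {I : Instance m T} {j : ℕ} {q : ℝ} {L : ℕ → ℝ} (h : I.IsPath j q L)
    {i : ℕ} (hji : j ≤ i) (hi : i ≤ T) : L i ≤ I.cumDemand T := by
  rw [← h.finish]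
  exact Nat.le_induction (P := fun n _ => n ≤ T → L i ≤ L n) (fun _ => le_rfl)
    (fun n hn ih hT => (ih (by omega)).trans (h.mono n (by omega) (by omega))) T hi le_rfl

theorem IsPath.cons {I : Instance m T} {j : ℕ} (hj : j < T) {q q' : ℝ} {L : ℕ → ℝ}
    (h : I.IsPath (j + 1) q' L) (hq : q ≤ q') :
    ∃ L', I.IsPath j q L' ∧ I.pathCost j L' =
      I.cost j (q' - q) + I.oracle j (q' - I.cumDemand (j + 1)) + I.pathCost (j + 1) L := by
  have hL : ∀ i, j + 1 ≤ i → Function.update L j q i = L i := fun i hi =>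
    Function.update_of_ne (by omega) _ _
  refine ⟨Function.update L j q, ⟨Function.update_self _ _ _, ?_, fun i h₁ h₂ => ?_⟩, ?_⟩
  · rw [hL T hj, h.finish]
  · rcases h₁.eq_or_lt with rfl | h₁
    · rw [Function.update_self, hL _ le_rfl, h.start]
      exact hq
    · rw [hL i h₁, hL _ (by omega)]
      exact h.mono i h₁ h₂
  · rw [I.pathCost_succ hj, hL _ le_rfl, Function.update_self, h.start]
    congr 1
    unfold pathCost
    refine Finset.sum_congr rfl fun i hi => ?_
    have := (Finset.mem_Ico.mp hi).1
    rw [hL i this, hL _ (by omega)]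

/-- The value of the last period. -/
theorem isPathValue_last (hT : 1 ≤ T) (Z : Set ℝ) {q : ℝ} (hq : q ≤ I.cumDemand T) :
    I.IsPathValue Z (T - 1) q (I.cost (T - 1) (I.cumDemand T - q)) := by
  have hT1 : T - 1 + 1 = T := by omega
  have hc : ∀ L, I.IsPath (T - 1) q L →
      I.pathCost (T - 1) L = I.cost (T - 1) (I.cumDemand T - q) := by
    intro L h
    rw [I.pathCost_succ (by omega), hT1, h.start, h.finish, sub_self, oracle_zero]
    simp [pathCost]
  refine ⟨?_, fun L h _ => (hc L h).ge⟩
  have hp : I.IsPath (T - 1) q fun i => if i < T then q else I.cumDemand T :=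
    ⟨by simp; omega, by simp, fun j h₁ h₂ => by
      have : ¬ (j + 1 < T) := by omega
      simp [h₂, this, hq]⟩
  exact ⟨_, hp, (hc _ hp).le⟩

/-- The dynamic programming step. -/
theorem isPathValue_step {N : ℕ} {a f : ℕ → ℝ} {j : ℕ} (hj : j < T)
    (hf : ∀ r < N, I.IsPathValue {z | ∃ r < N, a r = z} (j + 1) (a r) (f r)) {r : ℕ} (hr : r < N)
    {v : ℝ} (hsound : ∃ r' < N, a r ≤ a r' ∧
      I.cost j (a r' - a r) + (I.oracle j (a r' - I.cumDemand (j + 1)) + f r') ≤ v)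
    (hstay : v ≤ I.oracle j (a r - I.cumDemand (j + 1)) + f r)
    (hmove : ∀ r' < N, a r < a r' →
      v ≤ I.cost j (a r' - a r) + (I.oracle j (a r' - I.cumDemand (j + 1)) + f r')) :
    I.IsPathValue {z | ∃ r < N, a r = z} j (a r) v := by
  constructor
  · obtain ⟨r', hr', hle, hv⟩ := hsound
    obtain ⟨L, hL, hc⟩ := (hf r' hr').1
    obtain ⟨L', hL', hc'⟩ := hL.cons hj hle
    exact ⟨L', hL', by linarith⟩
  · intro L hL hZ
    obtain ⟨r', hr', he⟩ := hZ (j + 1) (by omega) (by omega)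
    have hmono := hL.mono j le_rfl hj
    rw [I.pathCost_succ hj]
    rw [hL.start, ← he] at hmono ⊢
    have htail : I.IsPath (j + 1) (a r') L := he ▸ hL.tail
    have hZ' : ∀ i, j + 1 ≤ i → i ≤ T → L i ∈ {z | ∃ r < N, a r = z} := fun i h₁ h₂ =>
      hZ i (by omega) h₂
    -- The list of levels may contain duplicates: equality of levels does not mean `r = r'`, but
    -- producing nothing is then covered by the entry `r` itself.
    rcases hmono.eq_or_lt with h | h
    · rw [← h, sub_self, cost_zero]
      have := (hf r hr).2 L (h ▸ htail) hZ'
      linarith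
    · have h₁ := (hf r' hr').2 L htail hZ'
      linarith [hmove r' hr' h]

/-! ## Paths and production plans -/

/-- Each summand is an increment of `L - D`, so the sum telescopes, and `L - D` vanishes at `u`. -/
theorem inventory_eq {u : Fin T} {X : Fin T → ℝ} {L : ℕ → ℝ} (hu : L u = I.cumDemand u)
    (hX : ∀ i, u ≤ i → X i = L (i + 1) - L i) {j : Fin T} (hj : u ≤ j) :
    I.inventory u X j = L (j + 1) - I.cumDemand (j + 1) := by
  have h₁ : I.inventory u X j = ∑ i ∈ Finset.Icc u j,
      (fun i : ℕ => (L (i + 1) - I.cumDemand (i + 1)) - (L i - I.cumDemand i))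
        (Fin.valEmbedding i) := by
    refine Finset.sum_congr rfl fun i hi => ?_
    have hd : I.demand i = I.d i := by simp [demand, input]
    simp only [Fin.valEmbedding_apply]
    rw [hX i (Finset.mem_Icc.mp hi).1, cumDemand_succ, hd]
    ring
  rw [h₁, ← Finset.sum_map (Finset.Icc u j) Fin.valEmbedding
    (fun i : ℕ => (L (i + 1) - I.cumDemand (i + 1)) - (L i - I.cumDemand i)),
    Fin.map_valEmbedding_Icc, ← Finset.Ico_add_one_right_eq_Icc,
    Finset.sum_Ico_sub (fun i => L i - I.cumDemand i) (by have : (u : ℕ) ≤ j := hj; omega), hu]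
  ring

theorem totalCost_eq {u : Fin T} {X : Fin T → ℝ} {L : ℕ → ℝ} (hu : L u = I.cumDemand u)
    (hX : ∀ i, u ≤ i → X i = L (i + 1) - L i) : I.totalCost u X = I.pathCost u L := by
  have h₁ : I.totalCost u X = ∑ i ∈ Finset.Ici u,
      (fun j : ℕ => I.cost j (L (j + 1) - L j) + I.oracle j (L (j + 1) - I.cumDemand (j + 1)))
        (Fin.valEmbedding i) := by
    refine Finset.sum_congr rfl fun i hi => ?_
    have hui := Finset.mem_Ici.mp hi
    rw [I.inventory_eq hu hX hui, hX i hui]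
    simp [cost, oracle]
  rw [h₁, ← Finset.sum_map (Finset.Ici u) Fin.valEmbedding
    (fun j : ℕ => I.cost j (L (j + 1) - L j) + I.oracle j (L (j + 1) - I.cumDemand (j + 1))),
    Fin.map_valEmbedding_Ici]
  rfl

theorem feasible_of_isPath {u : Fin T} {L : ℕ → ℝ} (h : I.IsPath u (I.cumDemand u) L) :
    I.Feasible u fun i => L (i + 1) - L i := by
  refine ⟨fun j hj => sub_nonneg.mpr (h.mono j hj j.2), fun j hj => ?_⟩
  have huj : u ≤ j := by
    have := u.2
    exact Fin.le_def.mpr (by omega)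
  rw [I.inventory_eq h.start (fun _ _ => rfl) huj, hj, h.finish, sub_self]

theorem exists_isPath_of_feasible {u : Fin T} {X : Fin T → ℝ} (h : I.Feasible u X) :
    ∃ L, I.IsPath u (I.cumDemand u) L ∧ I.pathCost u L = I.totalCost u X := by
  let x : ℕ → ℝ := fun i => if hi : i < T then X ⟨i, hi⟩ else 0
  let L : ℕ → ℝ := fun j => I.cumDemand u + ∑ i ∈ Finset.Ico (u : ℕ) j, x i
  have hu : L u = I.cumDemand u := by simp [L]
  have hL : ∀ j, (u : ℕ) ≤ j → L (j + 1) - L j = x j := fun j hj => by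
    simp only [L, Finset.sum_Ico_succ_top hj]; ring
  have hX : ∀ i, u ≤ i → X i = L (i + 1) - L i := fun i hi => by
    rw [hL i hi]; simp [x]
  refine ⟨L, ⟨hu, ?_, fun j h₁ h₂ => ?_⟩, (I.totalCost_eq hu hX).symm⟩
  · have huT := u.2
    have hT1 : T - 1 + 1 = T := by omega
    have hle : u ≤ (⟨T - 1, by omega⟩ : Fin T) := Fin.le_def.mpr (by simp; omega)
    have := h.2 ⟨T - 1, by omega⟩ hT1
    rw [I.inventory_eq hu hX hle] at this
    simp only [hT1] at this
    linarith
  · have := h.1 ⟨j, h₂⟩ (Fin.le_def.mpr h₁)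
    rw [hX ⟨j, h₂⟩ (Fin.le_def.mpr h₁)] at this
    exact sub_nonneg.mp this

/-- A path never exceeds its final level `D T`, so levels above it may be missing from `Z`. The
lower bound on grid paths extends to all paths by `exists_path_in_levels`; applied to the witness
path, it shows that the value is attained. -/
theorem isCostToGo_of_isPathValue
    (hlsc : ∀ j, LowerSemicontinuousOn (I.prodCost j) (Set.Ici 0)) {Z : Set ℝ}
    (hZ : ∀ z ∈ I.levels m, z ≤ I.cumDemand T → z ∈ Z) {u : Fin T} {v : ℝ}
    (h : I.IsPathValue Z u (I.cumDemand u) v) : I.IsCostToGo u v := by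
  have hlb : ∀ L, I.IsPath u (I.cumDemand u) L → v ≤ I.pathCost u L := fun L hL => by
    obtain ⟨L', hL', hc, hm⟩ := I.exists_path_in_levels hlsc hL
    exact (h.2 L' hL' fun i h₁ h₂ => hZ _ (hm i h₁ h₂) (hL'.le_finish h₁ h₂)).trans hc
  constructor
  · obtain ⟨L, hL, hc⟩ := h.1
    exact ⟨_, I.feasible_of_isPath hL,
      (I.totalCost_eq hL.start fun _ _ => rfl).trans (le_antisymm hc (hlb L hL))⟩
  · rintro _ ⟨X, hX, rfl⟩
    obtain ⟨L, hL, hc⟩ := I.exists_isPath_of_feasible hX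
    exact hc ▸ hlb L hL

end Instance


/-! ## A program logic that counts loop iterations -/

namespace Program

/-- Total cost of all elementary operations that occur in a program. -/
def size : Program → ℕ
  | skip => 1
  | setNat _ _ i e => 1 + ∑ j, (i j).cost + e.cost
  | setReal _ _ i x => 1 + ∑ j, (i j).cost + x.cost
  | seq P Q => P.size + Q.size
  | ite b P Q => b.cost + P.size + Q.size
  | loop b P => b.cost + P.size

/-- Arrays of natural numbers to which a program assigns. -/
def natWrites : Program → List ℕ
  | skip => []
  | setNat a _ _ _ => [a]
  | setReal _ _ _ _ => []
  | seq P Q => P.natWrites ++ Q.natWrites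
  | ite _ P Q => P.natWrites ++ Q.natWrites
  | loop _ P => P.natWrites

/-- Arrays of real numbers to which a program assigns. -/
def realWrites : Program → List ℕ
  | skip => []
  | setNat _ _ _ _ => []
  | setReal a _ _ _ => [a]
  | seq P Q => P.realWrites ++ Q.realWrites
  | ite _ P Q => P.realWrites ++ Q.realWrites
  | loop _ P => P.realWrites

/-- The arrays to which `P` does not assign are the same in `σ` and `σ'`. -/
structure Agree (P : Program) (σ σ' : State) : Prop where
  nat : ∀ a ∉ P.natWrites, σ'.nat a = σ.nat a
  real : ∀ a ∉ P.realWrites, σ'.real a = σ.real a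

theorem Agree.refl (P : Program) (σ : State) : P.Agree σ σ := ⟨fun _ _ => rfl, fun _ _ => rfl⟩

theorem Agree.trans {P : Program} {σ₁ σ₂ σ₃ : State} (h₁ : P.Agree σ₁ σ₂) (h₂ : P.Agree σ₂ σ₃) :
    P.Agree σ₁ σ₃ :=
  ⟨fun a ha => (h₂.nat a ha).trans (h₁.nat a ha), fun a ha => (h₂.real a ha).trans (h₁.real a ha)⟩

theorem Agree.mono {P Q : Program} {σ σ' : State} (h : P.Agree σ σ')
    (hn : P.natWrites ⊆ Q.natWrites) (hr : P.realWrites ⊆ Q.realWrites) : Q.Agree σ σ' :=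
  ⟨fun a ha => h.nat a fun h' => ha (hn h'), fun a ha => h.real a fun h' => ha (hr h')⟩

end Program

variable {h : ℕ → ℝ → ℝ} {W : ℕ}

/-- A syntactic frame rule: invariants need not mention arrays that a program does not write. -/
theorem Exec.agree {P : Program} {σ σ' : State} {t : ℕ} (he : Exec h W P σ σ' t) :
    P.Agree σ σ' := by
  induction he with
  | skip => exact .refl _ _
  | setNat a k i e σ hW =>
    refine ⟨fun a' ha' => ?_, fun _ _ => rfl⟩
    have : a' ≠ a := by simpa [Program.natWrites] using ha'
    funext j
    simp [State.setNat, this]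
  | setReal a k i e σ =>
    refine ⟨fun _ _ => rfl, fun a' ha' => ?_⟩
    have : a' ≠ a := by simpa [Program.realWrites] using ha'
    funext j
    simp [State.setReal, this]
  | seq _ _ ih₁ ih₂ =>
    exact (ih₁.mono (List.subset_append_left _ _) (List.subset_append_left _ _)).trans
      (ih₂.mono (List.subset_append_right _ _) (List.subset_append_right _ _))
  | ite_true _ _ ih => exact ih.mono (List.subset_append_left _ _) (List.subset_append_left _ _)
  | ite_false _ _ ih => exact ih.mono (List.subset_append_right _ _) (List.subset_append_right _ _)
  | loop_true _ _ _ ih₁ ih₂ => exact Program.Agree.trans ⟨ih₁.nat, ih₁.real⟩ ih₂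
  | loop_false => exact .refl _ _

/-- `P` halts when started in `σ`; the final memory `σ'` and the number `n` of loop iterations
satisfy `Q`. -/
def Reaches (h : ℕ → ℝ → ℝ) (W : ℕ) (P : Program) (σ : State) (Q : State → ℕ → Prop) : Prop :=
  ∃ σ' t n, Exec h W P σ σ' t ∧ t ≤ P.size * (n + 1) ∧ Q σ' n

namespace Reaches

variable {P P' : Program} {σ : State} {Q Q' : State → ℕ → Prop}

/-- The rule of consequence, with the frame property available when weakening. -/
theorem imp (hP : Reaches h W P σ Q) (hQ : ∀ σ' n, P.Agree σ σ' → Q σ' n → Q' σ' n) :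
    Reaches h W P σ Q' := by
  obtain ⟨σ', t, n, he, ht, hq⟩ := hP
  exact ⟨σ', t, n, he, ht, hQ _ _ he.agree hq⟩

theorem skip (hQ : Q σ 0) : Reaches h W .skip σ Q :=
  ⟨σ, 1, 0, .skip σ, le_rfl, hQ⟩

theorem setNat {a k : ℕ} {i : Fin k → NatExpr} {e : NatExpr} (hW : e.eval σ < W)
    (hQ : Q (σ.setNat a (List.ofFn fun j => (i j).eval σ) (e.eval σ)) 0) :
    Reaches h W (.setNat a k i e) σ Q :=
  ⟨_, _, 0, .setNat a k i e σ hW, by simp [Program.size], hQ⟩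

theorem setReal {a k : ℕ} {i : Fin k → NatExpr} {x : RealExpr}
    (hQ : Q (σ.setReal a (List.ofFn fun j => (i j).eval σ) (x.eval h σ)) 0) :
    Reaches h W (.setReal a k i x) σ Q :=
  ⟨_, _, 0, .setReal a k i x σ, by simp [Program.size], hQ⟩

theorem seq (hP : Reaches h W P σ fun σ₁ n₁ => Reaches h W P' σ₁ fun σ₂ n₂ => Q σ₂ (n₁ + n₂)) :
    Reaches h W (.seq P P') σ Q := by
  obtain ⟨σ₁, t₁, n₁, he₁, ht₁, σ₂, t₂, n₂, he₂, ht₂, hq⟩ := hP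
  refine ⟨σ₂, _, _, .seq he₁ he₂, ?_, hq⟩
  simp only [Program.size]
  calc t₁ + t₂ ≤ P.size * (n₁ + 1) + P'.size * (n₂ + 1) := add_le_add ht₁ ht₂
    _ ≤ P.size * (n₁ + n₂ + 1) + P'.size * (n₁ + n₂ + 1) := by gcongr <;> omega
    _ = _ := by ring

theorem ite {b : Test} (h₁ : b.Holds h σ → Reaches h W P σ Q)
    (h₂ : ¬ b.Holds h σ → Reaches h W P' σ Q) : Reaches h W (.ite b P P') σ Q := by
  by_cases hb : b.Holds h σ
  · obtain ⟨σ', t, n, he, ht, hq⟩ := h₁ hb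
    refine ⟨σ', _, n, .ite_true hb he, ?_, hq⟩
    simp only [Program.size]
    nlinarith [Nat.zero_le (b.cost * n), Nat.zero_le (P'.size * (n + 1))]
  · obtain ⟨σ', t, n, he, ht, hq⟩ := h₂ hb
    refine ⟨σ', _, n, .ite_false hb he, ?_, hq⟩
    simp only [Program.size]
    nlinarith [Nat.zero_le (b.cost * n), Nat.zero_le (P.size * (n + 1))]

/-- The rule for loops, with an invariant that may mention the number of iterations so far. -/
theorem loop {b : Test} (Inv : State → ℕ → Prop) (φ : State → ℕ) (h0 : Inv σ 0)
    (hstep : ∀ σ' n, P.Agree σ σ' → Inv σ' n → b.Holds h σ' →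
      Reaches h W P σ' fun σ'' n' => Inv σ'' (n + n' + 1) ∧ φ σ'' < φ σ') :
    Reaches h W (.loop b P) σ fun σ' n => Inv σ' n ∧ ¬ b.Holds h σ' := by
  -- Generalised to a loop that has already made `n` iterations, for induction on the variant `φ`.
  have key : ∀ k σ' n, φ σ' = k → P.Agree σ σ' → Inv σ' n →
      Reaches h W (.loop b P) σ' fun σ'' n' => Inv σ'' (n + n') ∧ ¬ b.Holds h σ'' := by
    intro k
    induction k using Nat.strong_induction_on with
    | _ k ih =>
      intro σ' n hk ha hi
      by_cases hb : b.Holds h σ'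
      · obtain ⟨σ₁, t₁, n₁, he₁, ht₁, hi₁, hφ⟩ := hstep σ' n ha hi hb
        obtain ⟨σ₂, t₂, n₂, he₂, ht₂, hi₂, hb₂⟩ := ih _ (hk ▸ hφ) σ₁ _ rfl (ha.trans he₁.agree) hi₁
        -- The iteration counted for this pass pays for its test and for the extra `1` in the time
        -- bound of the body.
        refine ⟨σ₂, _, n₁ + n₂ + 1, .loop_true hb he₁ he₂, ?_, ?_, hb₂⟩
        · simp only [Program.size] at ht₂ ⊢
          nlinarith [Nat.zero_le (b.cost * n₁)]
        · rwa [show n + (n₁ + n₂ + 1) = n + n₁ + 1 + n₂ by ring]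
      · exact ⟨σ', _, 0, .loop_false hb, by simp [Program.size], hi, hb⟩
  simpa using key _ σ 0 rfl (.refl _ _) h0

end Reaches

/-! ## Abbreviations for programs -/

namespace NatExpr

/-- A scalar variable. -/
def var (a : ℕ) : NatExpr := .get a 0 ![]

/-- An entry of a vector. -/
def entry (a : ℕ) (i : NatExpr) : NatExpr := .get a 1 ![i]

@[simp] theorem eval_var (σ : State) (a : ℕ) : (var a).eval σ = σ.nat a [] := by
  simp [var, eval]

@[simp] theorem eval_entry (σ : State) (a : ℕ) (i : NatExpr) :
    (entry a i).eval σ = σ.nat a [i.eval σ] := by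
  simp [entry, eval]

@[simp] theorem eval_lit (σ : State) (n : ℕ) : (lit n).eval σ = n := rfl

@[simp] theorem eval_add (σ : State) (e₁ e₂ : NatExpr) :
    (add e₁ e₂).eval σ = e₁.eval σ + e₂.eval σ := rfl

@[simp] theorem eval_sub (σ : State) (e₁ e₂ : NatExpr) :
    (sub e₁ e₂).eval σ = e₁.eval σ - e₂.eval σ := rfl

end NatExpr

namespace RealExpr

/-- A scalar variable. -/
def var (a : ℕ) : RealExpr := .get a 0 ![]

/-- An entry of a vector. -/
def entry (a : ℕ) (i : NatExpr) : RealExpr := .get a 1 ![i]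

/-- An entry of a matrix. -/
def entry₂ (a : ℕ) (i j : NatExpr) : RealExpr := .get a 2 ![i, j]

@[simp] theorem eval_var (σ : State) (a : ℕ) : (var a).eval h σ = σ.real a [] := by
  simp [var, eval]

@[simp] theorem eval_entry (σ : State) (a : ℕ) (i : NatExpr) :
    (entry a i).eval h σ = σ.real a [i.eval σ] := by
  simp [entry, eval]

@[simp] theorem eval_entry₂ (σ : State) (a : ℕ) (i j : NatExpr) :
    (entry₂ a i j).eval h σ = σ.real a [i.eval σ, j.eval σ] := by
  simp [entry₂, eval]

@[simp] theorem eval_lit (σ : State) (n : ℕ) : (lit n).eval h σ = n := rfl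

@[simp] theorem eval_add (σ : State) (x₁ x₂ : RealExpr) :
    (add x₁ x₂).eval h σ = x₁.eval h σ + x₂.eval h σ := rfl

@[simp] theorem eval_sub (σ : State) (x₁ x₂ : RealExpr) :
    (sub x₁ x₂).eval h σ = x₁.eval h σ - x₂.eval h σ := rfl

@[simp] theorem eval_mul (σ : State) (x₁ x₂ : RealExpr) :
    (mul x₁ x₂).eval h σ = x₁.eval h σ * x₂.eval h σ := rfl

@[simp] theorem eval_oracle (σ : State) (e : NatExpr) (x : RealExpr) :
    (oracle e x).eval h σ = h (e.eval σ) (x.eval h σ) := rfl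

end RealExpr

namespace Test

@[simp] theorem holds_natLE (σ : State) (e₁ e₂ : NatExpr) :
    (natLE e₁ e₂).Holds h σ ↔ e₁.eval σ ≤ e₂.eval σ := Iff.rfl

@[simp] theorem holds_realLE (σ : State) (x₁ x₂ : RealExpr) :
    (realLE x₁ x₂).Holds h σ ↔ x₁.eval h σ ≤ x₂.eval h σ := Iff.rfl

@[simp] theorem holds_not (σ : State) (b : Test) : (not b).Holds h σ ↔ ¬ b.Holds h σ := Iff.rfl

@[simp] theorem holds_and (σ : State) (b₁ b₂ : Test) :
    (and b₁ b₂).Holds h σ ↔ b₁.Holds h σ ∧ b₂.Holds h σ := Iff.rfl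

/-- Strict inequality of natural numbers. -/
def natLT (e₁ e₂ : NatExpr) : Test := natLE (e₁.add (.lit 1)) e₂

@[simp] theorem holds_natLT (σ : State) (e₁ e₂ : NatExpr) :
    (natLT e₁ e₂).Holds h σ ↔ e₁.eval σ < e₂.eval σ := Iff.rfl

end Test

namespace State

@[simp] theorem nat_setNat (σ : State) (a : ℕ) (i : List ℕ) (v a' : ℕ) (i' : List ℕ) :
    (σ.setNat a i v).nat a' i' = if a' = a ∧ i' = i then v else σ.nat a' i' := rfl

@[simp] theorem real_setNat (σ : State) (a : ℕ) (i : List ℕ) (v : ℕ) :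
    (σ.setNat a i v).real = σ.real := rfl

@[simp] theorem real_setReal (σ : State) (a : ℕ) (i : List ℕ) (v : ℝ) (a' : ℕ) (i' : List ℕ) :
    (σ.setReal a i v).real a' i' = if a' = a ∧ i' = i then v else σ.real a' i' := rfl

@[simp] theorem nat_setReal (σ : State) (a : ℕ) (i : List ℕ) (v : ℝ) :
    (σ.setReal a i v).nat = σ.nat := rfl

end State

namespace Program

/-- Assignment to a scalar variable. -/
def assignNat (a : ℕ) (e : NatExpr) : Program := .setNat a 0 ![] e

/-- Assignment to an entry of a vector. -/
def storeNat (a : ℕ) (i e : NatExpr) : Program := .setNat a 1 ![i] e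

/-- Assignment to a scalar variable. -/
def assignReal (a : ℕ) (x : RealExpr) : Program := .setReal a 0 ![] x

/-- Assignment to an entry of a vector. -/
def storeReal (a : ℕ) (i : NatExpr) (x : RealExpr) : Program := .setReal a 1 ![i] x

/-- Assignment to an entry of a matrix. -/
def storeReal₂ (a : ℕ) (i j : NatExpr) (x : RealExpr) : Program := .setReal a 2 ![i, j] x

/-- The program of a loop in which the variable `v` runs through the numbers below `e`. -/
def forBelow (v : ℕ) (e : NatExpr) (P : Program) : Program :=
  .seq (assignNat v (.lit 0))
    (.loop (.natLT (.var v) e) (.seq P (assignNat v ((NatExpr.var v).add (.lit 1)))))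

section writes

variable (a v : ℕ) (i j e : NatExpr) (x : RealExpr) (b : Test) (P Q : Program)

@[simp] theorem natWrites_skip : skip.natWrites = [] := rfl
@[simp] theorem natWrites_assignNat : (assignNat a e).natWrites = [a] := rfl
@[simp] theorem natWrites_storeNat : (storeNat a i e).natWrites = [a] := rfl
@[simp] theorem natWrites_assignReal : (assignReal a x).natWrites = [] := rfl
@[simp] theorem natWrites_storeReal : (storeReal a i x).natWrites = [] := rfl
@[simp] theorem natWrites_storeReal₂ : (storeReal₂ a i j x).natWrites = [] := rfl
@[simp] theorem natWrites_seq : (seq P Q).natWrites = P.natWrites ++ Q.natWrites := rfl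
@[simp] theorem natWrites_ite : (ite b P Q).natWrites = P.natWrites ++ Q.natWrites := rfl
@[simp] theorem natWrites_loop : (loop b P).natWrites = P.natWrites := rfl
@[simp] theorem natWrites_forBelow :
    (forBelow v e P).natWrites = v :: (P.natWrites ++ [v]) := rfl
@[simp] theorem realWrites_skip : skip.realWrites = [] := rfl
@[simp] theorem realWrites_assignNat : (assignNat a e).realWrites = [] := rfl
@[simp] theorem realWrites_storeNat : (storeNat a i e).realWrites = [] := rfl
@[simp] theorem realWrites_assignReal : (assignReal a x).realWrites = [a] := rfl
@[simp] theorem realWrites_storeReal : (storeReal a i x).realWrites = [a] := rfl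
@[simp] theorem realWrites_storeReal₂ : (storeReal₂ a i j x).realWrites = [a] := rfl
@[simp] theorem realWrites_seq : (seq P Q).realWrites = P.realWrites ++ Q.realWrites := rfl
@[simp] theorem realWrites_ite : (ite b P Q).realWrites = P.realWrites ++ Q.realWrites := rfl
@[simp] theorem realWrites_loop : (loop b P).realWrites = P.realWrites := rfl
@[simp] theorem realWrites_forBelow : (forBelow v e P).realWrites = P.realWrites ++ [] := rfl

end writes

end Program

/-! ### Rules for assignments and counted loops -/

namespace Reaches

variable {P P' : Program} {σ : State} {Q Q' : State → ℕ → Prop}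

theorem assignNat {a : ℕ} {e : NatExpr} (hW : e.eval σ < W) (hQ : Q (σ.setNat a [] (e.eval σ)) 0) :
    Reaches h W (.assignNat a e) σ Q :=
  setNat hW (by simpa using hQ)

theorem storeNat {a : ℕ} {i e : NatExpr} (hW : e.eval σ < W)
    (hQ : Q (σ.setNat a [i.eval σ] (e.eval σ)) 0) : Reaches h W (.storeNat a i e) σ Q :=
  setNat hW (by simpa using hQ)

theorem assignReal {a : ℕ} {x : RealExpr} (hQ : Q (σ.setReal a [] (x.eval h σ)) 0) :
    Reaches h W (.assignReal a x) σ Q :=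
  setReal (by simpa using hQ)

theorem storeReal {a : ℕ} {i : NatExpr} {x : RealExpr}
    (hQ : Q (σ.setReal a [i.eval σ] (x.eval h σ)) 0) : Reaches h W (.storeReal a i x) σ Q :=
  setReal (by simpa using hQ)

theorem storeReal₂ {a : ℕ} {i j : NatExpr} {x : RealExpr}
    (hQ : Q (σ.setReal a [i.eval σ, j.eval σ] (x.eval h σ)) 0) :
    Reaches h W (.storeReal₂ a i j x) σ Q :=
  setReal (by simpa using hQ)

/-- The rule for counting loops. -/
theorem forBelow {v N : ℕ} {e : NatExpr} (Inv : ℕ → State → ℕ → Prop) (hNW : N < W)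
    (hv : v ∉ P.natWrites)
    (he : ∀ σ', (Program.forBelow v e P).Agree σ σ' → e.eval σ' = N)
    (h0 : Inv 0 (σ.setNat v [] 0) 0)
    (hstep : ∀ k < N, ∀ σ' n, (Program.forBelow v e P).Agree σ σ' → σ'.nat v [] = k →
      Inv k σ' n →
      Reaches h W P σ' fun σ'' n' => Inv (k + 1) (σ''.setNat v [] (k + 1)) (n + n' + 1)) :
    Reaches h W (.forBelow v e P) σ fun σ' n => Inv N σ' n := by
  have hsub : ∀ σ' σ'', (Program.seq P (.assignNat v ((NatExpr.var v).add (.lit 1)))).Agree σ' σ'' →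
      (Program.forBelow v e P).Agree σ' σ'' := fun σ' σ'' ha =>
    ha.mono (fun x hx => by
      simp only [Program.forBelow, Program.natWrites, Program.assignNat, List.mem_append] at hx ⊢
      tauto) (fun x hx => by
      simp only [Program.forBelow, Program.realWrites, Program.assignNat, List.mem_append] at hx ⊢
      tauto)
  have h₀ : (Program.forBelow v e P).Agree σ (σ.setNat v [] 0) := by
    refine ⟨fun a ha => ?_, fun _ _ => rfl⟩
    have : a ≠ v := by
      rintro rfl
      simp [Program.forBelow, Program.natWrites, Program.assignNat] at ha
    funext j
    simp [this]
  refine seq (assignNat (by simp only [NatExpr.eval_lit]; omega) ?_)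
  refine imp (loop (fun σ' n => σ'.nat v [] ≤ N ∧ Inv (σ'.nat v []) σ' n)
    (fun σ' => N - σ'.nat v []) ⟨by simp, by simpa using h0⟩ ?_) ?_
  · rintro σ' n ha ⟨hle, hi⟩ hb
    have ha' : (Program.forBelow v e P).Agree σ σ' := h₀.trans (hsub _ _ ha)
    simp only [Test.holds_natLT, NatExpr.eval_var, he σ' ha'] at hb
    refine seq (imp (hstep _ hb σ' n ha' rfl hi) fun σ'' n' hag hi' => ?_)
    have hvv : σ''.nat v [] = σ'.nat v [] := by rw [hag.nat v hv]
    refine assignNat (by simp only [NatExpr.eval_add, NatExpr.eval_var, NatExpr.eval_lit]; omega) ?_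
    simp only [NatExpr.eval_add, NatExpr.eval_var, NatExpr.eval_lit, State.nat_setNat, and_self,
      if_true, hvv, add_zero]
    exact ⟨⟨hb, hi'⟩, by omega⟩
  · rintro σ' n ha ⟨⟨hle, hi⟩, hb⟩
    simp only [Test.holds_natLT, NatExpr.eval_var, he σ' (h₀.trans (hsub _ _ ⟨ha.nat, ha.real⟩))] at hb
    have : σ'.nat v [] = N := by omega
    rw [zero_add]
    exact this ▸ hi

end Reaches


/-! ## Memory layout

Natural-number scalars: `0` number of periods, `1` current row of levels, `2` its length, `3` and
`4` row to be shifted and its length, `5` breakpoint, `6` shift, `7` and `8` positions in a merge,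
`9` period, `10` level, `11` piece, `12` and `13` ends of the queue, `14` next level to enter the
queue, `16` layer.  The vector `15` holds the queue.

Real arrays: `0` to `3` input, `4` output, `6` rows of levels (row `0`: cumulative demands),
`7` and `8` shifts, `9` values of periods and levels, `10` cost-to-go from the end of the current
period, `12` lower end of the current piece, `13` production in the last period. -/

/-! ## Merging sorted sequences -/

/-- `o` is the merge of the first `x` entries of `a` and the first `y` entries of `b`. -/
structure MergeInv (a b : ℕ → ℝ) (N M x y : ℕ) (o : ℕ → ℝ) : Prop where
  hx : x ≤ N
  hy : y ≤ M
  sorted : ∀ i j, i ≤ j → j < x + y → o i ≤ o j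
  bound_left : ∀ i < x + y, x < N → o i ≤ a x
  bound_right : ∀ i < x + y, y < M → o i ≤ b y
  left : ∀ i < x, ∃ r < x + y, o r = a i
  right : ∀ i < y, ∃ r < x + y, o r = b i

/-- Lets `push_left` treat both branches of the merge. -/
theorem MergeInv.symm {a b o : ℕ → ℝ} {N M x y : ℕ} (h : MergeInv a b N M x y o) :
    MergeInv b a M N y x o := by
  obtain ⟨h₁, h₂, h₃, h₄, h₅, h₆, h₇⟩ := h
  rw [add_comm x y] at *
  exact ⟨h₂, h₁, h₃, h₅, h₄, h₇, h₆⟩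

/-- The appended entry dominates the output so far by `bound_left`, and is at most both remaining
heads, so all bounds persist. -/
theorem MergeInv.push_left {a b o o' : ℕ → ℝ} {N M x y : ℕ} (h : MergeInv a b N M x y o)
    (ha : ∀ i j, i ≤ j → j < N → a i ≤ a j) (hx : x < N) (hxy : y < M → a x ≤ b y)
    (ho : ∀ i < x + y, o' i = o i) (hn : o' (x + y) = a x) :
    MergeInv a b N M (x + 1) y o' := by
  have hcase : ∀ i < x + 1 + y, i < x + y ∨ i = x + y := fun i hi => by omega
  refine ⟨hx, h.hy, fun i j hij hj => ?_, fun i hi hx' => ?_, fun i hi hy => ?_, fun i hi => ?_,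
    fun i hi => ?_⟩
  · rcases hcase j hj with hj | rfl
    · rw [ho i (by omega), ho j hj]
      exact h.sorted i j hij hj
    · rcases hij.eq_or_lt with rfl | hij
      · exact le_rfl
      · rw [ho i hij, hn]
        exact h.bound_left i hij hx
  · rcases hcase i hi with hi | rfl
    · rw [ho i hi]
      exact (h.bound_left i hi hx).trans (ha _ _ (by omega) hx')
    · rw [hn]
      exact ha _ _ (by omega) hx'
  · rcases hcase i hi with hi | rfl
    · rw [ho i hi]
      exact h.bound_right i hi hy
    · rw [hn]
      exact hxy hy
  · by_cases hix : i = x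
    · exact ⟨x + y, by omega, by rw [hn, hix]⟩
    · obtain ⟨r, hr, he⟩ := h.left i (by omega)
      exact ⟨r, by omega, by rw [ho r hr, he]⟩
  · obtain ⟨r, hr, he⟩ := h.right i hi
    exact ⟨r, by omega, by rw [ho r hr, he]⟩

open Program NatExpr in
/-- Merge the current level row (row number in `1`, length in `2`) with the row of number `3` and
length `4`, shifted by the real scalar `7`, into the next row, which becomes the current one. -/
def mergeProg : Program :=
  .seq (assignNat 7 (.lit 0)) <| .seq (assignNat 8 (.lit 0)) <|
  .seq (.loop (.natLT (.add (var 7) (var 8)) (.add (var 2) (var 4)))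
    (.ite (.and (.natLT (var 8) (var 4)) (.not (.and (.natLT (var 7) (var 2))
        (.realLE (.entry₂ 6 (var 1) (var 7)) (.add (.entry₂ 6 (var 3) (var 8)) (.var 7))))))
      (.seq (storeReal₂ 6 (.add (var 1) (.lit 1)) (.add (var 7) (var 8))
          (.add (.entry₂ 6 (var 3) (var 8)) (.var 7)))
        (assignNat 8 (.add (var 8) (.lit 1))))
      (.seq (storeReal₂ 6 (.add (var 1) (.lit 1)) (.add (var 7) (var 8))
          (.entry₂ 6 (var 1) (var 7)))
        (assignNat 7 (.add (var 7) (.lit 1)))))) <|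
  .seq (assignNat 1 (.add (var 1) (.lit 1))) (assignNat 2 (.add (var 2) (var 4)))

/-- The first `N` entries of row `g` of the real array `6` are sorted and contain the set `S`. -/
structure Row (σ : State) (g N : ℕ) (S : Set ℝ) : Prop where
  sorted : ∀ i j, i ≤ j → j < N → σ.real 6 [g, i] ≤ σ.real 6 [g, j]
  mem : ∀ z ∈ S, ∃ r < N, σ.real 6 [g, r] = z

theorem Row.congr {σ σ' : State} {g N : ℕ} {S : Set ℝ} (h : Row σ g N S)
    (he : ∀ r, σ'.real 6 [g, r] = σ.real 6 [g, r]) : Row σ' g N S := by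
  constructor
  · simpa only [he] using h.sorted
  · simpa only [he] using h.mem

/-- Every iteration emits one entry. The output goes to the fresh row `g + 1`, so the source rows
survive and row `b` can be merged again with other shifts. -/
theorem reaches_mergeProg {h : ℕ → ℝ → ℝ} {W : ℕ} {σ : State} {g N b M : ℕ} {S S' : Set ℝ}
    (hg : σ.nat 1 [] = g) (hN : σ.nat 2 [] = N) (hb : σ.nat 3 [] = b) (hM : σ.nat 4 [] = M)
    (hbg : b ≤ g) (hS : Row σ g N S) (hS' : Row σ b M S') (hW : N + M < W) (hW' : g + 1 < W) :
    Reaches h W mergeProg σ fun σ' n => n = N + M ∧ σ'.nat 1 [] = g + 1 ∧ σ'.nat 2 [] = N + M ∧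
      Row σ' (g + 1) (N + M) (S ∪ {z | ∃ y ∈ S', z = y + σ.real 7 []}) ∧
      ∀ g' ≤ g, ∀ r, σ'.real 6 [g', r] = σ.real 6 [g', r] := by
  set a : ℕ → ℝ := fun r => σ.real 6 [g, r]
  set c : ℕ → ℝ := fun r => σ.real 6 [b, r] + σ.real 7 []
  have ha : ∀ i j, i ≤ j → j < N → a i ≤ a j := hS.sorted
  have hc : ∀ i j, i ≤ j → j < M → c i ≤ c j := fun i j h₁ h₂ =>
    add_le_add_left (hS'.sorted i j h₁ h₂) _
  refine .seq (.assignNat (by simp; omega) (.seq (.assignNat (by simp; omega) ?_)))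
  refine .seq (.imp (.loop (fun σ' n => n = σ'.nat 7 [] + σ'.nat 8 [] ∧
    MergeInv a c N M (σ'.nat 7 []) (σ'.nat 8 []) (fun r => σ'.real 6 [g + 1, r]) ∧
    ∀ g' ≤ g, ∀ r, σ'.real 6 [g', r] = σ.real 6 [g', r])
    (fun σ' => N + M - (σ'.nat 7 [] + σ'.nat 8 [])) ?_ ?_) ?_)
  · simp only [State.nat_setNat, State.real_setNat]
    exact ⟨by simp, ⟨by simp, by simp, by simp, by simp, by simp, by simp, by simp⟩, by simp⟩
  · rintro σ' n hag ⟨hn, hinv, hrow⟩ hlt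
    have h1 : σ'.nat 1 [] = g := by rw [hag.nat 1 (by simp)]; simpa
    have h2 : σ'.nat 2 [] = N := by rw [hag.nat 2 (by simp)]; simpa
    have h3 : σ'.nat 3 [] = b := by rw [hag.nat 3 (by simp)]; simpa
    have h4 : σ'.nat 4 [] = M := by rw [hag.nat 4 (by simp)]; simpa
    have h7 : σ'.real 7 = σ.real 7 := by rw [hag.real 7 (by simp)]; simp
    obtain ⟨x, hx⟩ : ∃ x, x = σ'.nat 7 [] := ⟨_, rfl⟩
    obtain ⟨y, hy⟩ : ∃ y, y = σ'.nat 8 [] := ⟨_, rfl⟩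
    simp only [Test.holds_natLT, NatExpr.eval_add, NatExpr.eval_var, h2, h4, ← hx, ← hy] at hlt
    rw [← hx, ← hy] at hinv hn
    have hxN := hinv.hx
    have hyM := hinv.hy
    have ea : σ'.real 6 [g, x] = a x := hrow g le_rfl x
    have ec : σ'.real 6 [b, y] + σ.real 7 [] = c y := by rw [hrow b hbg y]
    refine .ite (fun hb => ?_) (fun hb => ?_)
    all_goals
      simp only [Test.holds_natLT, Test.holds_and, Test.holds_not, Test.holds_realLE,
        NatExpr.eval_var, RealExpr.eval_entry₂, RealExpr.eval_add, RealExpr.eval_var,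
        h1, h2, h3, h4, h7, ← hx, ← hy, ea, ec] at hb
    · refine .seq (.storeReal₂ (.assignNat (by simp [← hy]; omega) ?_))
      simp only [NatExpr.eval_var, RealExpr.eval_entry₂, RealExpr.eval_add, RealExpr.eval_var,
        NatExpr.eval_add, NatExpr.eval_lit, State.nat_setNat, State.real_setNat, State.nat_setReal,
        State.real_setReal, h1, h2, h3, h4, h7, ← hx, ← hy, ea, ec]
      refine ⟨⟨by simp [hn]; ring, ?_, ?_⟩, by simp; omega⟩
      · simp only [Nat.reduceEqDiff, and_true, if_false, if_true]
        refine (hinv.symm.push_left hc hb.1 (fun hxN => ?_) (fun i hi => ?_) ?_).symm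
        · by_contra hcon
          exact hb.2 ⟨hxN, (not_le.mp hcon).le⟩
        · have : i ≠ x + y := by omega
          simp [this]
        · simp [add_comm]
      · intro g' hg' r
        have : g' ≠ g + 1 := by omega
        simp [this, hrow g' hg' r]
    -- If the left row were exhausted, the loop guard would leave an entry on the right, and the
    -- test would have chosen it.
    · have hxN' : x < N := by
        by_contra hcon
        exact hb ⟨by omega, fun h => hcon h.1⟩
      refine .seq (.storeReal₂ (.assignNat (by simp [← hx]; omega) ?_))
      simp only [NatExpr.eval_var, RealExpr.eval_entry₂, RealExpr.eval_add, RealExpr.eval_var,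
        NatExpr.eval_add, NatExpr.eval_lit, State.nat_setNat, State.real_setNat, State.nat_setReal,
        State.real_setReal, h1, h2, h3, h4, h7, ← hx, ← hy, ea, ec]
      refine ⟨⟨by simp [hn]; ring, ?_, ?_⟩, by simp; omega⟩
      · simp only [Nat.reduceEqDiff, and_true, if_false, if_true]
        refine hinv.push_left ha hxN' (fun hyM => ?_) (fun i hi => ?_) ?_
        · by_contra hcon
          exact hb ⟨hyM, fun h => hcon h.2⟩
        · have : i ≠ x + y := by omega
          simp [this]
        · simp
      · intro g' hg' r
        have : g' ≠ g + 1 := by omega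
        simp [this, hrow g' hg' r]
  · rintro σ' n hag ⟨⟨hn, hinv, hrow⟩, hlt⟩
    have h1 : σ'.nat 1 [] = g := by rw [hag.nat 1 (by simp)]; simpa
    have h2 : σ'.nat 2 [] = N := by rw [hag.nat 2 (by simp)]; simpa
    have h4 : σ'.nat 4 [] = M := by rw [hag.nat 4 (by simp)]; simpa
    simp only [Test.holds_natLT, NatExpr.eval_add, NatExpr.eval_var, h2, h4] at hlt
    have hxN := hinv.hx
    have hyM := hinv.hy
    have e7 : σ'.nat 7 [] = N := by omega
    have e8 : σ'.nat 8 [] = M := by omega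
    rw [e7, e8] at hinv hn
    refine .seq (.assignNat (by simp [h1]; omega) (.assignNat (by simp [h2, h4]; omega) ?_))
    simp only [NatExpr.eval_var, NatExpr.eval_add, NatExpr.eval_lit, State.nat_setNat,
      State.real_setNat, h1, h2, h4]
    refine ⟨by omega, by simp, by simp, ⟨hinv.sorted, ?_⟩, hrow⟩
    rintro z (hz | ⟨y, hy, rfl⟩)
    · obtain ⟨r, hr, rfl⟩ := hS.mem z hz
      exact hinv.left r hr
    · obtain ⟨r, hr, rfl⟩ := hS'.mem y hy
      exact hinv.right r hr


/-! ## The sorted list of levels -/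

theorem Row.mono {σ : State} {g N : ℕ} {S S' : Set ℝ} (h : Row σ g N S)
    (hs : ∀ z ∈ S', z ∈ S) : Row σ g N S' :=
  ⟨h.sorted, fun z hz => h.mem z (hs z hz)⟩

/-- The memory holds the input. -/
structure Instance.Loaded {m T : ℕ} (I : Instance m T) (σ : State) : Prop where
  nat : σ.nat 0 [] = T
  demand : ∀ j, σ.real 0 [j] = I.demand j
  bp : ∀ l, σ.real 1 [l] = I.bp l
  setup : σ.real 2 = I.input.real 2
  unit : σ.real 3 = I.input.real 3

theorem Instance.Loaded.congr {m T : ℕ} {I : Instance m T} {σ σ' : State} (h : I.Loaded σ)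
    (hn : σ'.nat 0 = σ.nat 0) (h0 : σ'.real 0 = σ.real 0) (h1 : σ'.real 1 = σ.real 1)
    (h2 : σ'.real 2 = σ.real 2) (h3 : σ'.real 3 = σ.real 3) : I.Loaded σ' := by
  constructor
  · rw [hn, h.nat]
  · rw [h0]; exact h.demand
  · rw [h1]; exact h.bp
  · rw [h2, h.setup]
  · rw [h3, h.unit]

theorem Instance.loaded_input {m T : ℕ} (I : Instance m T) : I.Loaded I.input :=
  ⟨by simp [Instance.input], fun _ => rfl, fun _ => rfl, rfl, rfl⟩

open Program NatExpr

/-- Extend the current row by all its shifts by `k` times breakpoint number `5`, where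
`|k| ≤ T`. -/
def roundProg : Program :=
  .seq (assignNat 3 (var 1)) <| .seq (assignNat 4 (var 2)) <| .seq (assignReal 8 (.lit 0)) <|
  forBelow 6 (var 0) <|
    .seq (assignReal 8 (.add (.var 8) (.entry 1 (var 5)))) <| .seq (assignReal 7 (.var 8)) <|
    .seq mergeProg <| .seq (assignReal 7 (.sub (.lit 0) (.var 8))) mergeProg

variable {m T : ℕ} {I : Instance m T}

/-- After `k` rounds the current row holds the shifts by `n` breakpoints with `|n| ≤ k`; two merges
add `n = k + 1` and `n = -(k + 1)`. Each merge outputs at most `N * (2 * T + 1)` entries. Duplicates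
are kept, so lengths are known exactly. -/
theorem reaches_roundProg {σ : State} {g N i : ℕ} (hI : I.Loaded σ) (h1 : σ.nat 1 [] = g)
    (h2 : σ.nat 2 [] = N) (h5 : σ.nat 5 [] = i) (hrow : Row σ g N (I.levels i))
    (hNW : N * (2 * T + 1) < W) (hgW : g + 2 * T < W) :
    Reaches h W roundProg σ fun σ' n => n ≤ T * (2 * (N * (2 * T + 1)) + 1) ∧
      σ'.nat 1 [] = g + 2 * T ∧ σ'.nat 2 [] = N * (2 * T + 1) ∧
      Row σ' (g + 2 * T) (N * (2 * T + 1)) (I.levels (i + 1)) ∧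
      ∀ g' ≤ g, ∀ r, σ'.real 6 [g', r] = σ.real 6 [g', r] := by
  have hNW' : N ≤ N * (2 * T + 1) := Nat.le_mul_of_pos_right _ (by omega)
  refine .seq (.assignNat (by simp [h1]; omega) (.seq (.assignNat (by simp [h2]; omega)
    (.seq (.assignReal ?_)))))
  refine .imp (.forBelow (N := T) (fun k σ' n => n ≤ k * (2 * (N * (2 * T + 1)) + 1) ∧
    σ'.nat 1 [] = g + 2 * k ∧ σ'.nat 2 [] = N * (2 * k + 1) ∧
    Row σ' (g + 2 * k) (N * (2 * k + 1))
      {z | ∃ y ∈ I.levels i, ∃ n : ℤ, |n| ≤ k ∧ z = y + n * I.bp i} ∧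
    σ'.real 8 [] = k * I.bp i ∧
    ∀ g' ≤ g, ∀ r, σ'.real 6 [g', r] = σ.real 6 [g', r]) (by omega) ?_ ?_ ?_ ?_) ?_
  · simp [mergeProg]
  · intro σ' hag
    rw [eval_var, hag.nat 0 (by simp [mergeProg])]
    simp [hI.nat]
  · refine ⟨by simp, by simp [h1], by simp [h2], ?_, by simp, by simp⟩
    rw [mul_zero, zero_add, mul_one, add_zero]
    refine (hrow.congr (fun r => by simp)).mono ?_
    rintro z ⟨y, hy, n, hn, rfl⟩
    have : n = 0 := by simpa using hn
    simpa [this] using hy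
  · rintro k hk σ' n hag h6 ⟨hn, g1, g2, hr, g8, hold⟩
    have g3 : σ'.nat 3 [] = g := by rw [hag.nat 3 (by simp [mergeProg])]; simp [h1]
    have g4 : σ'.nat 4 [] = N := by rw [hag.nat 4 (by simp [mergeProg])]; simp [h2]
    have g5 : σ'.nat 5 [] = i := by rw [hag.nat 5 (by simp [mergeProg])]; simp [h5]
    have gb : σ'.real 1 [i] = I.bp i := by
      rw [hag.real 1 (by simp [mergeProg])]; simp [hI.bp]
    have hk2 : N * (2 * k + 3) ≤ N * (2 * T + 1) := Nat.mul_le_mul_left _ (by omega)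
    have e1 : N * (2 * k + 1) + N = N * (2 * k + 2) := by ring
    have e2 : N * (2 * k + 2) + N = N * (2 * k + 3) := by ring
    refine .seq (.assignReal (.seq (.assignReal (.seq ?_))))
    refine .imp (reaches_mergeProg (g := g + 2 * k) (N := N * (2 * k + 1)) (b := g) (M := N)
      (by simpa) (by simpa) (by simpa) (by simpa) (by omega) (hr.congr fun r => by simp)
      (hrow.congr fun r => by simpa using hold g le_rfl r) (by omega) (by omega)) ?_
    rintro σ₁ n₁ hag₁ ⟨hn₁, f1, f2, hr₁, hold₁⟩
    have f3 : σ₁.nat 3 [] = g := by rw [hag₁.nat 3 (by simp [mergeProg])]; simpa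
    have f4 : σ₁.nat 4 [] = N := by rw [hag₁.nat 4 (by simp [mergeProg])]; simpa
    have f8 : σ₁.real 8 [] = (k + 1) * I.bp i := by
      rw [hag₁.real 8 (by simp [mergeProg])]
      simp [g8, g5, gb]; ring
    rw [e1] at f2 hr₁
    refine .seq (.assignReal ?_)
    refine .imp (reaches_mergeProg (g := g + 2 * k + 1) (N := N * (2 * k + 2)) (b := g) (M := N)
      (by simpa) (by simpa) (by simpa) (by simpa) (by omega) (hr₁.congr fun r => by simp)
      (hrow.congr fun r => by
        simpa [hold g le_rfl r] using hold₁ g (by omega) r) (by omega) (by omega)) ?_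
    rintro σ₂ n₂ hag₂ ⟨hn₂, k1, k2, hr₂, hold₂⟩
    have k8 : σ₂.real 8 [] = (k + 1) * I.bp i := by
      rw [hag₂.real 8 (by simp [mergeProg])]; simpa using f8
    rw [e2] at k2 hr₂
    have e3 : N * (2 * (k + 1) + 1) = N * (2 * k + 3) := by ring
    refine ⟨?_, by simp [k1]; ring, by rw [e3]; simpa using k2, ?_, by simpa using k8, ?_⟩
    · rw [add_mul k 1]
      omega
    · rw [e3, show g + 2 * (k + 1) = g + 2 * k + 1 + 1 by ring]
      refine (hr₂.congr fun r => by simp).mono ?_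
      rintro z ⟨y, hy, n, hn, rfl⟩
      -- Coefficients already covered come from the old row, the two new ones from the two merges.
      by_cases hnk : |n| ≤ k
      · exact Or.inl (Or.inl ⟨y, hy, n, hnk, rfl⟩)
      · have hn' : n = k + 1 ∨ n = -(k + 1) := by
          push_cast at hn
          rcases abs_cases n with ⟨h', _⟩ | ⟨h', _⟩ <;> omega
        rcases hn' with rfl | rfl
        · refine Or.inl (Or.inr ⟨y, hy, ?_⟩)
          simp [g8, g5, gb]; ring
        · refine Or.inr ⟨y, hy, ?_⟩
          simp [f8]; ring
    · intro g' hg' r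
      rw [State.real_setNat, hold₂ g' (by omega) r, State.real_setReal, if_neg (by simp),
        hold₁ g' (by omega) r]
      simpa using hold g' hg' r
  · rintro σ' n hag ⟨hn, g1, g2, hr, g8, hold⟩
    simp only [zero_add, add_zero]
    exact ⟨hn, g1, g2, hr, hold⟩

/-- Compute the sorted list of all levels that are at most the total demand.  Row `0` holds the
cumulative demands. -/
def gridProg (m : ℕ) : Program :=
  .seq (forBelow 10 (var 0) (storeReal₂ 6 (.lit 0) (.add (var 10) (.lit 1))
    (.add (.entry₂ 6 (.lit 0) (var 10)) (.entry 0 (var 10))))) <|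
  .seq (assignNat 1 (.lit 0)) <|
  .seq (assignNat 2 (.add (var 0) (.lit 1))) <|
  .seq (forBelow 5 (.lit m) roundProg) <|
  .loop (.and (.natLT (.lit 0) (var 2)) (.not (.realLE (.entry₂ 6 (var 1) (.sub (var 2) (.lit 1)))
    (.entry₂ 6 (.lit 0) (var 0))))) (assignNat 2 (.sub (var 2) (.lit 1)))

/-- Bound for the number of levels. -/
def gridSize (m T : ℕ) : ℕ := (T + 1) * (2 * T + 1) ^ m

/-- The memory holds the input, the cumulative demands in row `0` of the real array `6`, and a
sorted list `a` of `N` levels in the row with number `g`. -/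
structure GridReady (I : Instance m T) (σ : State) (g N : ℕ) (a : ℕ → ℝ) : Prop where
  loaded : I.Loaded σ
  cum : ∀ j ≤ T, σ.real 6 [0, j] = I.cumDemand j
  row : σ.nat 1 [] = g
  len : σ.nat 2 [] = N
  entry : ∀ r, σ.real 6 [g, r] = a r
  sorted : ∀ i j, i ≤ j → j < N → a i ≤ a j
  le : ∀ r < N, a r ≤ I.cumDemand T
  mem : ∀ z ∈ I.levels m, z ≤ I.cumDemand T → ∃ r < N, a r = z

theorem GridReady.of_agree {σ σ' : State} {g N : ℕ} {a : ℕ → ℝ} {P : Program}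
    (h : GridReady I σ g N a) (hP : P.Agree σ σ') (hn : ∀ a ∈ [0, 1, 2], a ∉ P.natWrites)
    (hr : ∀ a ∈ [0, 1, 2, 3, 6], a ∉ P.realWrites) : GridReady I σ' g N a := by
  have n0 := hP.nat 0 (hn 0 (by simp))
  have n1 := hP.nat 1 (hn 1 (by simp))
  have n2 := hP.nat 2 (hn 2 (by simp))
  have r6 := hP.real 6 (hr 6 (by simp))
  refine ⟨h.loaded.congr n0 (hP.real 0 (hr 0 (by simp))) (hP.real 1 (hr 1 (by simp)))
    (hP.real 2 (hr 2 (by simp))) (hP.real 3 (hr 3 (by simp))), ?_, ?_, ?_, ?_, h.sorted, h.le, h.mem⟩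
  · rw [r6]; exact h.cum
  · rw [n1, h.row]
  · rw [n2, h.len]
  · rw [r6]; exact h.entry

/-- One round per breakpoint turns the `T + 1` cumulative demands into all levels; the geometric
growth of the rows is bounded crudely by the final size in each round. In the word bound, `2 * T *
m` accounts for row numbers. -/
theorem reaches_gridProg (hW : gridSize m T + 2 * T * m + m < W) :
    Reaches h W (gridProg m) I.input fun σ' n =>
      n ≤ T + m * (T * (2 * gridSize m T + 1) + 1) + gridSize m T ∧
      ∃ g N a, N ≤ gridSize m T ∧ GridReady I σ' g N a := by
  have hI := I.loaded_input
  have hpow : ∀ i ≤ m, (T + 1) * (2 * T + 1) ^ i ≤ gridSize m T := fun i hi =>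
    Nat.mul_le_mul_left _ (Nat.pow_le_pow_right (by omega) hi)
  have hT := hpow 0 (Nat.zero_le _)
  rw [pow_zero, mul_one] at hT
  refine .seq (.imp (.forBelow (N := T) (fun k σ' n => n = k ∧
    ∀ j ≤ k, σ'.real 6 [0, j] = I.cumDemand j) (by omega) (by simp) ?_ ?_ ?_) ?_)
  · intro σ' hag
    rw [eval_var, hag.nat 0 (by simp), hI.nat]
  · refine ⟨rfl, fun j hj => ?_⟩
    have : j = 0 := by omega
    -- The first cumulative demand is never stored; the cell has its default value `0`.
    simp [this, Instance.cumDemand, Instance.input]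
  · rintro k hk σ' n hag h10 ⟨hn, hcum⟩
    refine .storeReal₂ ⟨by simpa using hn, fun j hj => ?_⟩
    have hd : σ'.real 0 [k] = I.demand k := by rw [hag.real 0 (by simp), hI.demand]
    simp only [State.real_setNat, State.real_setReal, eval_add, eval_var, eval_lit,
      RealExpr.eval_add, RealExpr.eval_entry, RealExpr.eval_entry₂, h10, hd, hcum k le_rfl]
    by_cases hjk : j = k + 1
    · simp [hjk, I.cumDemand_succ]
    · simp [hjk, hcum j (by omega)]
  -- The count of the first loop is the number of periods; from here on `n₁` stands for `T`.
  rintro σ₁ n₁ hag₁ ⟨rfl, hcum⟩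
  have hI₁ : I.Loaded σ₁ := hI.congr (hag₁.nat 0 (by simp)) (hag₁.real 0 (by simp))
    (hag₁.real 1 (by simp)) (hag₁.real 2 (by simp)) (hag₁.real 3 (by simp))
  refine .seq (.assignNat (by simp; omega) (.seq (.assignNat (by simp [hI₁.nat]; omega) ?_)))
  refine .seq (.imp (.forBelow (N := m) (fun k σ' n => n ≤ k * (n₁ * (2 * gridSize m n₁ + 1) + 1) ∧
    σ'.nat 1 [] = 2 * n₁ * k ∧ σ'.nat 2 [] = (n₁ + 1) * (2 * n₁ + 1) ^ k ∧
    Row σ' (2 * n₁ * k) ((n₁ + 1) * (2 * n₁ + 1) ^ k) (I.levels k) ∧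
    ∀ r, σ'.real 6 [0, r] = σ₁.real 6 [0, r]) (by omega) ?_ ?_ ?_ ?_) ?_)
  · simp [roundProg, mergeProg]
  · intro σ' _
    rfl
  · refine ⟨by simp, by simp, by simp [hI₁.nat], ⟨fun i j hij hj => ?_, ?_⟩, by simp⟩
    · simp only [State.real_setNat, mul_zero, pow_zero, mul_one] at hj ⊢
      rw [hcum i (by omega), hcum j (by omega)]
      exact I.cumDemand_mono hij
    · rintro z ⟨v, hv, rfl⟩
      exact ⟨v, by simp; omega, by simpa using hcum v hv⟩
  · rintro k hk σ' n hag h5 ⟨hn, g1, g2, hr, hold⟩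
    have hI' : I.Loaded σ' := hI₁.congr (by
        rw [hag.nat 0 (by simp [roundProg, mergeProg])]; funext i; simp)
      (by rw [hag.real 0 (by simp [roundProg, mergeProg])]; simp)
      (by rw [hag.real 1 (by simp [roundProg, mergeProg])]; simp)
      (by rw [hag.real 2 (by simp [roundProg, mergeProg])]; simp)
      (by rw [hag.real 3 (by simp [roundProg, mergeProg])]; simp)
    have hp := hpow (k + 1) hk
    rw [pow_succ, ← mul_assoc] at hp
    have hmk : 2 * n₁ * k + 2 * n₁ ≤ 2 * n₁ * m := by
      calc 2 * n₁ * k + 2 * n₁ = 2 * n₁ * (k + 1) := by ring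
        _ ≤ _ := Nat.mul_le_mul_left _ hk
    refine .imp (reaches_roundProg hI' g1 g2 h5 hr (by omega) (by omega)) ?_
    rintro σ'' n'' hag'' ⟨hn'', f1, f2, hr'', hold''⟩
    refine ⟨?_, by simp [f1]; ring, by simp [f2]; ring, ?_, fun r => ?_⟩
    · have : n₁ * (2 * ((n₁ + 1) * (2 * n₁ + 1) ^ k * (2 * n₁ + 1)) + 1) ≤
          n₁ * (2 * gridSize m n₁ + 1) := Nat.mul_le_mul_left _ (by omega)
      rw [add_mul k 1]
      omega
    · rw [show 2 * n₁ * (k + 1) = 2 * n₁ * k + 2 * n₁ by ring, pow_succ, ← mul_assoc]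
      exact hr''.congr fun r => by simp
    · rw [State.real_setNat, hold'' 0 (Nat.zero_le _), hold]
  rintro σ₂ n₂ hag₂ ⟨hn₂, g1, g2, hr, hold⟩
  have hI₂ : I.Loaded σ₂ := hI₁.congr (by
        rw [hag₂.nat 0 (by simp [roundProg, mergeProg])]; funext i; simp)
      (by rw [hag₂.real 0 (by simp [roundProg, mergeProg])]; simp)
      (by rw [hag₂.real 1 (by simp [roundProg, mergeProg])]; simp)
      (by rw [hag₂.real 2 (by simp [roundProg, mergeProg])]; simp)
      (by rw [hag₂.real 3 (by simp [roundProg, mergeProg])]; simp)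
  have hcum₂ : ∀ j ≤ n₁, σ₂.real 6 [0, j] = I.cumDemand j := fun j hj => by
    rw [hold, hcum j hj]
  -- Everything cut off exceeds the total demand. The row is sorted, so once its last entry is small
  -- enough, all remaining entries are.
  refine .imp (.loop (fun σ' n => n + σ'.nat 2 [] = gridSize m n₁ ∧
    ∀ r, σ'.nat 2 [] ≤ r → r < gridSize m n₁ → I.cumDemand n₁ < σ₂.real 6 [2 * n₁ * m, r])
    (fun σ' => σ'.nat 2 []) ⟨by rw [g2]; simp [gridSize], fun r h₁ h₂ => ?_⟩ ?_) ?_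
  · rw [g2] at h₁
    exact absurd h₂ (not_lt.mpr h₁)
  · rintro σ' n hag ⟨hn, hgt⟩ hb
    have f6 : σ'.real 6 = σ₂.real 6 := hag.real 6 (by simp)
    have f0 : σ'.nat 0 [] = n₁ := by rw [hag.nat 0 (by simp), hI₂.nat]
    have f1 : σ'.nat 1 [] = 2 * n₁ * m := by rw [hag.nat 1 (by simp), g1]
    simp only [Test.holds_and, Test.holds_natLT, Test.holds_not, Test.holds_realLE, eval_lit,
      eval_var, eval_sub, RealExpr.eval_entry₂, f6, f0, f1, hcum₂ n₁ le_rfl] at hb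
    refine .assignNat (by simp; omega) ?_
    simp only [State.nat_setNat, eval_sub, eval_var, eval_lit, and_self, if_true]
    refine ⟨⟨by omega, fun r h₁ h₂ => ?_⟩, by omega⟩
    by_cases hr' : r = σ'.nat 2 [] - 1
    · rw [hr']
      exact not_le.mp hb.2
    · exact hgt r (by omega) h₂
  · rintro σ' n hag ⟨⟨hn, hgt⟩, hb⟩
    have f6 : σ'.real 6 = σ₂.real 6 := hag.real 6 (by simp)
    have f0 : σ'.nat 0 [] = n₁ := by rw [hag.nat 0 (by simp), hI₂.nat]
    have f1 : σ'.nat 1 [] = 2 * n₁ * m := by rw [hag.nat 1 (by simp), g1]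
    simp only [Test.holds_and, Test.holds_natLT, Test.holds_not, Test.holds_realLE, eval_lit,
      eval_var, eval_sub, RealExpr.eval_entry₂, f6, f0, f1, hcum₂ n₁ le_rfl] at hb
    refine ⟨by omega, 2 * n₁ * m, σ'.nat 2 [], fun r => σ₂.real 6 [2 * n₁ * m, r], by omega,
      hI₂.congr (hag.nat 0 (by simp)) (hag.real 0 (by simp)) (hag.real 1 (by simp))
        (hag.real 2 (by simp)) (hag.real 3 (by simp)), fun j hj => by rw [f6, hcum₂ j hj], f1, rfl,
      fun r => by rw [f6], fun i j hij hj => hr.sorted i j hij ?_, fun r hr' => ?_,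
      fun z hz hle => ?_⟩
    · exact lt_of_lt_of_le hj (by show _ ≤ gridSize m n₁; omega)
    · have hlast : σ₂.real 6 [2 * n₁ * m, σ'.nat 2 [] - 1] ≤ I.cumDemand n₁ := by
        by_contra hcon
        exact hb ⟨by omega, hcon⟩
      refine (hr.sorted r (σ'.nat 2 [] - 1) (by omega) ?_).trans hlast
      show _ < gridSize m n₁
      omega
    · obtain ⟨r, hr', he⟩ := hr.mem z hz
      refine ⟨r, ?_, he⟩
      by_contra hcon
      have := hgt r (not_lt.mp hcon) hr'
      rw [he] at this
      exact absurd this (not_lt.mpr hle)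


/-! ## Sliding window minima with a monotone queue -/

/-- The queue `q hd, …, q (tl - 1)` of indices below `hi` with increasing weights `w` contains, for
every relevant index below `hi`, an index that is at least as large and has no larger weight. -/
structure Deque (w : ℕ → ℝ) (rel : ℕ → Prop) (q : ℕ → ℕ) (hd tl hi : ℕ) : Prop where
  hd_le : hd ≤ tl
  tl_le : tl ≤ hi
  lt : ∀ t, hd ≤ t → t < tl → q t < hi
  sorted : ∀ t t', hd ≤ t → t ≤ t' → t' < tl → w (q t) ≤ w (q t')
  cover : ∀ i < hi, rel i → ∃ t, hd ≤ t ∧ t < tl ∧ i ≤ q t ∧ w (q t) ≤ w i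

namespace Deque

variable {w : ℕ → ℝ} {rel rel' : ℕ → Prop} {q q' : ℕ → ℕ} {hd tl hi : ℕ}

theorem mono (h : Deque w rel q hd tl hi) (hr : ∀ i, rel' i → rel i) : Deque w rel' q hd tl hi :=
  ⟨h.hd_le, h.tl_le, h.lt, h.sorted, fun i hi h' => h.cover i hi (hr i h')⟩

/-- Before an index of weight `ω` is appended, only indices of weight below `ω` need a cover, and
the removed entry covers none of these. -/
theorem pop_back {ω : ℝ} (h : Deque w (fun i => rel i ∧ ¬ ω ≤ w i) q hd tl hi) (hlt : hd < tl)
    (hω : ω ≤ w (q (tl - 1))) : Deque w (fun i => rel i ∧ ¬ ω ≤ w i) q hd (tl - 1) hi := by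
  refine ⟨by omega, by have := h.tl_le; omega, fun t h₁ h₂ => h.lt t h₁ (by omega),
    fun t t' h₁ h₂ h₃ => h.sorted t t' h₁ h₂ (by omega), fun i hi hr => ?_⟩
  obtain ⟨t, h₁, h₂, h₃, h₄⟩ := h.cover i hi hr
  refine ⟨t, h₁, ?_, h₃, h₄⟩
  by_contra hcon
  have : t = tl - 1 := by omega
  exact hr.2 (hω.trans (this ▸ h₄))

/-- The new index is the largest so far, hence it covers every index whose weight is not smaller,
including those left without a cover by `pop_back`. -/
theorem push (h : Deque w (fun i => rel i ∧ ¬ w hi ≤ w i) q hd tl hi)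
    (hω : hd < tl → w (q (tl - 1)) < w hi) (hq : ∀ t < tl, q' t = q t) (hq' : q' tl = hi) :
    Deque w rel q' hd (tl + 1) (hi + 1) := by
  have hd_le := h.hd_le
  refine ⟨by omega, Nat.succ_le_succ h.tl_le, fun t h₁ h₂ => ?_, fun t t' h₁ h₂ h₃ => ?_,
    fun i hi' hr => ?_⟩
  · by_cases ht : t = tl
    · rw [ht, hq']; omega
    · rw [hq t (by omega)]
      have := h.lt t h₁ (by omega)
      omega
  · by_cases ht' : t' = tl
    · by_cases ht : t = tl
      · rw [ht, ht']
      · rw [ht', hq', hq t (by omega)]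
        exact (h.sorted t (tl - 1) h₁ (by omega) (by omega)).trans (hω (by omega)).le
    · rw [hq t (by omega), hq t' (by omega)]
      exact h.sorted t t' h₁ h₂ (by omega)
  · by_cases hw : w hi ≤ w i
    · exact ⟨tl, hd_le, by omega, by omega, by rwa [hq']⟩
    · have hne : i ≠ hi := fun he => hw (he ▸ le_rfl)
      obtain ⟨t, h₁, h₂, h₃, h₄⟩ := h.cover i (by omega) ⟨hr, hw⟩
      exact ⟨t, h₁, by omega, by rwa [hq t h₂], by rwa [hq t h₂]⟩

/-- The head covers only indices up to itself. That the queue is also sorted by index is not needed.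
-/
theorem pop_front (h : Deque w rel q hd tl hi) (hlt : hd < tl) (hr : ∀ i ≤ q hd, ¬ rel i) :
    Deque w rel q (hd + 1) tl hi := by
  refine ⟨hlt, h.tl_le, fun t h₁ h₂ => h.lt t (by omega) h₂,
    fun t t' h₁ h₂ h₃ => h.sorted t t' (by omega) h₂ h₃, fun i hi hr' => ?_⟩
  obtain ⟨t, h₁, h₂, h₃, h₄⟩ := h.cover i hi hr'
  refine ⟨t, ?_, h₂, h₃, h₄⟩
  by_contra hcon
  have : t = hd := by omega
  exact hr i (this ▸ h₃) hr'

end Deque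

/-- Weight of the level with index `e` in the window minimum for period `9` and piece `11`. -/
def weightExpr (e : NatExpr) : RealExpr :=
  .add (.entry 10 e) (.mul (.entry₂ 3 (var 9) (var 11)) (.entry₂ 6 (var 1) e))

/-- Append to the queue all levels up to the upper end of the window of level `10`. -/
def pushProg (m : ℕ) : Program :=
  .loop (.and (.natLT (var 14) (var 2)) (.not (.and (.natLT (var 11) (.lit m))
      (.not (.realLE (.entry₂ 6 (var 1) (var 14))
        (.add (.entry₂ 6 (var 1) (var 10)) (.entry 1 (var 11)))))))) <|
    .seq (.loop (.and (.natLT (var 12) (var 13))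
        (.realLE (weightExpr (var 14)) (weightExpr (entry 15 (.sub (var 13) (.lit 1))))))
      (assignNat 13 (.sub (var 13) (.lit 1)))) <|
    .seq (storeNat 15 (var 13) (var 14)) <|
    .seq (assignNat 13 (.add (var 13) (.lit 1))) (assignNat 14 (.add (var 14) (.lit 1)))

/-- Remove from the queue the levels below the window of level `10`. -/
def popProg : Program :=
  .loop (.and (.natLT (var 12) (var 13)) (.not (.realLE
      (.add (.entry₂ 6 (var 1) (var 10)) (.var 12)) (.entry₂ 6 (var 1) (entry 15 (var 12))))))
    (assignNat 12 (.add (var 12) (.lit 1)))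

@[simp] theorem natWrites_pushProg (m : ℕ) : (pushProg m).natWrites = [13, 15, 13, 14] := rfl
@[simp] theorem realWrites_pushProg (m : ℕ) : (pushProg m).realWrites = [] := rfl
@[simp] theorem natWrites_popProg : popProg.natWrites = [12] := rfl
@[simp] theorem realWrites_popProg : popProg.realWrites = [] := rfl

/-- Cost of moving from level `10` to the first level in the queue. -/
def candidateExpr : RealExpr :=
  .add (.entry₂ 2 (var 9) (var 11)) (.sub (weightExpr (entry 15 (var 12)))
    (.mul (.entry₂ 3 (var 9) (var 11)) (.entry₂ 6 (var 1) (var 10))))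

/-- Improve the values of period `9` by productions in piece `11`, whose lower end is the real
scalar `12`. -/
def windowProg (m : ℕ) : Program :=
  .seq (assignNat 12 (.lit 0)) <| .seq (assignNat 13 (.lit 0)) <| .seq (assignNat 14 (.lit 0)) <|
  forBelow 10 (var 2) <| .seq (pushProg m) <| .seq popProg <|
    .ite (.and (.natLT (var 12) (var 13)) (.realLE candidateExpr (.entry₂ 9 (var 9) (var 10))))
      (storeReal₂ 9 (var 9) (var 10) candidateExpr) .skip

@[simp] theorem natWrites_windowProg (m : ℕ) :
    (windowProg m).natWrites = [12, 13, 14, 10, 13, 15, 13, 14, 12, 10] := rfl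
@[simp] theorem realWrites_windowProg (m : ℕ) : (windowProg m).realWrites = [9] := rfl

/-- The data on which the window minima for period `j` and piece `l` depend. -/
structure WindowReady (I : Instance m T) (σ : State) (g N : ℕ) (a : ℕ → ℝ) (j l : ℕ) (f : ℕ → ℝ)
    (lo : ℝ) : Prop where
  grid : GridReady I σ g N a
  period : σ.nat 9 [] = j
  piece : σ.nat 11 [] = l
  value : ∀ r, σ.real 10 [r] = f r
  lower : σ.real 12 [] = lo

theorem WindowReady.of_agree {σ σ' : State} {g N j l : ℕ} {a f : ℕ → ℝ} {lo : ℝ} {P : Program}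
    (h : WindowReady I σ g N a j l f lo) (hP : P.Agree σ σ')
    (hn : ∀ a ∈ [0, 1, 2, 9, 11], a ∉ P.natWrites)
    (hr : ∀ a ∈ [0, 1, 2, 3, 6, 10, 12], a ∉ P.realWrites) : WindowReady I σ' g N a j l f lo := by
  refine ⟨h.grid.of_agree hP (fun a ha => hn a ?_) (fun a ha => hr a ?_), ?_, ?_, ?_, ?_⟩
  · simp only [List.mem_cons] at ha ⊢; tauto
  · simp only [List.mem_cons] at ha ⊢; tauto
  · rw [hP.nat 9 (hn 9 (by simp)), h.period]
  · rw [hP.nat 11 (hn 11 (by simp)), h.piece]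
  · rw [hP.real 10 (hr 10 (by simp))]; exact h.value
  · rw [hP.real 12 (hr 12 (by simp))]; exact h.lower

/-- Weight of a level in the window minimum for period `j` and piece `l`. -/
noncomputable def weight (I : Instance m T) (a : ℕ → ℝ) (j l : ℕ) (f : ℕ → ℝ) (r : ℕ) : ℝ :=
  f r + I.input.real 3 [j, l] * a r

section

variable {σ : State} {g N j l k : ℕ} {a f : ℕ → ℝ} {lo : ℝ} {rel : ℕ → Prop}

theorem WindowReady.eval_weight (hσ : WindowReady I σ g N a j l f lo) (e : NatExpr) :
    (weightExpr e).eval h σ = weight I a j l f (e.eval σ) := by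
  simp [weightExpr, weight, hσ.value, hσ.grid.entry, hσ.grid.row, hσ.period, hσ.piece,
    hσ.grid.loaded.unit]

/-- Amortised with the potential of twice the number of levels still to enter plus the queue length:
a push releases 2, of which one pays for the iteration and one for the longer queue; that one later
pays for the removal. -/
theorem reaches_pushProg (hσ : WindowReady I σ g N a j l f lo) (h10 : σ.nat 10 [] = k)
    (hdq : Deque (weight I a j l f) rel (fun t => σ.nat 15 [t]) (σ.nat 12 []) (σ.nat 13 [])
      (σ.nat 14 []))
    (hiN : σ.nat 14 [] ≤ N) (hup : ∀ i < σ.nat 14 [], l < m → a i ≤ a k + I.bp l) (hW : N < W) :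
    Reaches h W (pushProg m) σ fun σ' n =>
      Deque (weight I a j l f) rel (fun t => σ'.nat 15 [t]) (σ'.nat 12 []) (σ'.nat 13 [])
        (σ'.nat 14 []) ∧ σ'.nat 14 [] ≤ N ∧ (∀ i < σ'.nat 14 [], l < m → a i ≤ a k + I.bp l) ∧
      (∀ i, σ'.nat 14 [] ≤ i → i < N → l < m ∧ a k + I.bp l < a i) ∧
      n + 2 * (N - σ'.nat 14 []) + (σ'.nat 13 [] - σ'.nat 12 []) ≤
        2 * (N - σ.nat 14 []) + (σ.nat 13 [] - σ.nat 12 []) := by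
  refine .imp (.loop (fun σ' n =>
    Deque (weight I a j l f) rel (fun t => σ'.nat 15 [t]) (σ'.nat 12 []) (σ'.nat 13 [])
      (σ'.nat 14 []) ∧ σ'.nat 14 [] ≤ N ∧ (∀ i < σ'.nat 14 [], l < m → a i ≤ a k + I.bp l) ∧
    n + 2 * (N - σ'.nat 14 []) + (σ'.nat 13 [] - σ'.nat 12 []) ≤
        2 * (N - σ.nat 14 []) + (σ.nat 13 [] - σ.nat 12 []))
    (fun σ' => N - σ'.nat 14 []) ⟨hdq, hiN, hup, by omega⟩ ?_) ?_
  · rintro σ' n hag ⟨hdq', hiN', hup', hn⟩ hb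
    have hσ' := hσ.of_agree hag (by simp) (by simp)
    have g10 : σ'.nat 10 [] = k := by rw [hag.nat 10 (by simp), h10]
    simp only [Test.holds_and, Test.holds_natLT, Test.holds_not, Test.holds_realLE, eval_lit,
      eval_var, RealExpr.eval_entry₂, RealExpr.eval_entry, RealExpr.eval_add, hσ'.grid.row,
      hσ'.grid.len, hσ'.grid.entry, hσ'.piece, g10, hσ'.grid.loaded.bp] at hb
    obtain ⟨x, hx⟩ : ∃ x, x = σ'.nat 14 [] := ⟨_, rfl⟩
    rw [← hx] at hdq' hiN' hup' hn hb
    -- While the back is cleared, covers are required only for weights below that of the incoming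
    -- level `x`.
    refine .seq (.imp (.loop (fun σ₁ n₁ =>
      Deque (weight I a j l f) (fun i => rel i ∧ ¬ weight I a j l f x ≤ weight I a j l f i)
        (fun t => σ'.nat 15 [t]) (σ'.nat 12 []) (σ₁.nat 13 []) x ∧
      n₁ + (σ₁.nat 13 [] - σ'.nat 12 []) = σ'.nat 13 [] - σ'.nat 12 []) (fun σ₁ => σ₁.nat 13 [])
      ⟨hdq'.mono fun i hi => hi.1, by omega⟩ ?_) ?_)
    · rintro σ₁ n₁ hag₁ ⟨hdq₁, hn₁⟩ hb₁
      have hσ₁ := hσ'.of_agree hag₁ (by simp) (by simp)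
      have k12 : σ₁.nat 12 = σ'.nat 12 := hag₁.nat 12 (by simp)
      have k14 : σ₁.nat 14 = σ'.nat 14 := hag₁.nat 14 (by simp)
      have k15 : σ₁.nat 15 = σ'.nat 15 := hag₁.nat 15 (by simp)
      simp only [Test.holds_and, Test.holds_natLT, Test.holds_realLE, hσ₁.eval_weight, eval_var,
        eval_entry, eval_sub, eval_lit, k12, k14, k15, ← hx] at hb₁
      have htl := hdq₁.tl_le
      refine .assignNat (by simp only [eval_sub, eval_var, eval_lit]; omega) ?_
      simp only [State.nat_setNat, eval_sub, eval_var, eval_lit, and_self, if_true]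
      exact ⟨⟨hdq₁.pop_back hb₁.1 hb₁.2, by omega⟩, by omega⟩
    · rintro σ₁ n₁ hag₁ ⟨⟨hdq₁, hn₁⟩, hb₁⟩
      have hσ₁ := hσ'.of_agree hag₁ (by simp) (by simp)
      have k12 : σ₁.nat 12 = σ'.nat 12 := hag₁.nat 12 (by simp)
      have k14 : σ₁.nat 14 = σ'.nat 14 := hag₁.nat 14 (by simp)
      have k15 : σ₁.nat 15 = σ'.nat 15 := hag₁.nat 15 (by simp)
      simp only [Test.holds_and, Test.holds_natLT, Test.holds_realLE, hσ₁.eval_weight, eval_var,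
        eval_entry, eval_sub, eval_lit, k12, k14, k15, ← hx] at hb₁
      have htl := hdq₁.tl_le
      have hhd := hdq₁.hd_le
      refine .seq (.storeNat (by simp [k14, ← hx]; omega) (.seq (.assignNat (by simp; omega)
        (.assignNat (by simp [k14, ← hx]; omega) ?_))))
      simp only [State.nat_setNat, eval_var, eval_add, eval_lit, Nat.reduceEqDiff, false_and,
        and_true, if_true, if_false, k12, k14, k15, ← hx, List.cons.injEq, true_and]
      refine ⟨⟨hdq₁.push (fun hlt => not_le.mp fun h' => hb₁ ⟨hlt, h'⟩) (fun t ht => ?_) ?_,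
        by omega, fun i hi hl => ?_, by omega⟩, by omega⟩
      · have : t ≠ σ₁.nat 13 [] := by omega
        simp [this]
      · simp
      · by_cases hix : i = x
        · by_contra hcon
          exact hb.2 ⟨hl, by rwa [← hix]⟩
        · exact hup' i (by omega) hl
  · rintro σ' n hag ⟨⟨hdq', hiN', hup', hn⟩, hb⟩
    have hσ' := hσ.of_agree hag (by simp) (by simp)
    have g10 : σ'.nat 10 [] = k := by rw [hag.nat 10 (by simp), h10]
    simp only [Test.holds_and, Test.holds_natLT, Test.holds_not, Test.holds_realLE, eval_lit,
      eval_var, RealExpr.eval_entry₂, RealExpr.eval_entry, RealExpr.eval_add, hσ'.grid.row,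
      hσ'.grid.len, hσ'.grid.entry, hσ'.piece, g10, hσ'.grid.loaded.bp] at hb
    refine ⟨hdq', hiN', hup', fun i hi hiN => ?_, hn⟩
    have hlt : σ'.nat 14 [] < N := by omega
    by_contra hcon
    refine hb ⟨hlt, fun h' => hcon ⟨h'.1, (not_le.mp h'.2).trans_le ?_⟩⟩
    exact hσ'.grid.sorted _ _ hi hiN

/-- A head below the window of level `k` is below the windows of all later levels, since levels are
sorted; so is every index it covers. -/
theorem reaches_popProg (hσ : WindowReady I σ g N a j l f lo) (h10 : σ.nat 10 [] = k)
    (hdq : Deque (weight I a j l f) (fun i => ∃ r, k ≤ r ∧ r < N ∧ a r + lo ≤ a i)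
      (fun t => σ.nat 15 [t]) (σ.nat 12 []) (σ.nat 13 []) (σ.nat 14 []))
    (hiN : σ.nat 14 [] ≤ N) (hW : N < W) :
    Reaches h W popProg σ fun σ' n =>
      Deque (weight I a j l f) (fun i => ∃ r, k ≤ r ∧ r < N ∧ a r + lo ≤ a i)
        (fun t => σ.nat 15 [t]) (σ'.nat 12 []) (σ.nat 13 []) (σ.nat 14 []) ∧
      (σ'.nat 12 [] < σ.nat 13 [] → a k + lo ≤ a (σ.nat 15 [σ'.nat 12 []])) ∧
      n + (σ.nat 13 [] - σ'.nat 12 []) = σ.nat 13 [] - σ.nat 12 [] := by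
  refine .imp (.loop (fun σ' n =>
    Deque (weight I a j l f) (fun i => ∃ r, k ≤ r ∧ r < N ∧ a r + lo ≤ a i)
        (fun t => σ.nat 15 [t]) (σ'.nat 12 []) (σ.nat 13 []) (σ.nat 14 []) ∧
      n + (σ.nat 13 [] - σ'.nat 12 []) = σ.nat 13 [] - σ.nat 12 [])
    (fun σ' => σ.nat 13 [] - σ'.nat 12 []) ⟨hdq, by omega⟩ ?_) ?_
  · rintro σ' n hag ⟨hdq', hn⟩ hb
    have hσ' := hσ.of_agree hag (by simp) (by simp)
    have g10 : σ'.nat 10 [] = k := by rw [hag.nat 10 (by simp), h10]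
    have k13 : σ'.nat 13 = σ.nat 13 := hag.nat 13 (by simp)
    have k15 : σ'.nat 15 = σ.nat 15 := hag.nat 15 (by simp)
    simp only [Test.holds_and, Test.holds_natLT, Test.holds_not, Test.holds_realLE,
      eval_var, eval_entry, RealExpr.eval_entry₂, RealExpr.eval_var, RealExpr.eval_add,
      hσ'.grid.row, hσ'.grid.entry, hσ'.lower, g10, k13, k15] at hb
    have htl := hdq'.tl_le
    refine .assignNat (by simp only [eval_add, eval_var, eval_lit]; omega) ?_
    simp only [State.nat_setNat, eval_add, eval_var, eval_lit, and_self, if_true]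
    refine ⟨⟨hdq'.pop_front hb.1 ?_, by omega⟩, by omega⟩
    rintro i hi ⟨r, hkr, hrN, hr⟩
    have hlt := hdq'.lt _ le_rfl hb.1
    have h₁ := hσ.grid.sorted i _ hi (by omega)
    have h₂ := hσ.grid.sorted k r hkr hrN
    exact hb.2 (by linarith)
  · rintro σ' n hag ⟨⟨hdq', hn⟩, hb⟩
    have hσ' := hσ.of_agree hag (by simp) (by simp)
    have g10 : σ'.nat 10 [] = k := by rw [hag.nat 10 (by simp), h10]
    have k13 : σ'.nat 13 = σ.nat 13 := hag.nat 13 (by simp)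
    have k15 : σ'.nat 15 = σ.nat 15 := hag.nat 15 (by simp)
    simp only [Test.holds_and, Test.holds_natLT, Test.holds_not, Test.holds_realLE,
      eval_var, eval_entry, RealExpr.eval_entry₂, RealExpr.eval_var, RealExpr.eval_add,
      hσ'.grid.row, hσ'.grid.entry, hσ'.lower, g10, k13, k15] at hb
    refine ⟨hdq', fun hlt => ?_, hn⟩
    by_contra hcon
    exact hb ⟨hlt, hcon⟩

/-- The condition that moving from level `r` to level `i` is a production in the closed
piece `l`, whose lower end is `lo`. -/
def InWindow (I : Instance m T) (a : ℕ → ℝ) (l : ℕ) (lo : ℝ) (r i : ℕ) : Prop :=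
  lo ≤ a i - a r ∧ (l < m → a i - a r ≤ I.bp l)

/-- Both ends of the window move up with the start level, so each level enters and leaves the queue
at most once: `N` iterations of the outer loop and `2 * N` for the queue. -/
theorem reaches_windowProg (hσ : WindowReady I σ g N a j l f lo) (hW : N < W) :
    Reaches h W (windowProg m) σ fun σ' n => n ≤ 3 * N ∧
      (∀ r < N, σ'.real 9 [j, r] ≤ σ.real 9 [j, r]) ∧
      (∀ r < N, σ'.real 9 [j, r] = σ.real 9 [j, r] ∨ ∃ i < N, InWindow I a l lo r i ∧
        I.line j l (a i - a r) + f i = σ'.real 9 [j, r]) ∧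
      (∀ r < N, ∀ i < N, InWindow I a l lo r i →
        σ'.real 9 [j, r] ≤ I.line j l (a i - a r) + f i) ∧
      ∀ j' ≠ j, ∀ r, σ'.real 9 [j', r] = σ.real 9 [j', r] := by
  refine .seq (.assignNat (by simp; omega) (.seq (.assignNat (by simp; omega)
    (.seq (.assignNat (by simp; omega) ?_)))))
  -- Window conditions are stated for all `r` with `k ≤ r < N`, not for `k` alone: they then pass to
  -- `k + 1` and are vacuous at `k = N`, where `a N` means nothing.
  refine .imp (.forBelow (N := N) (fun k σ' n =>
    Deque (weight I a j l f) (fun i => ∃ r, k ≤ r ∧ r < N ∧ a r + lo ≤ a i)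
      (fun t => σ'.nat 15 [t]) (σ'.nat 12 []) (σ'.nat 13 []) (σ'.nat 14 []) ∧
    σ'.nat 14 [] ≤ N ∧
    (∀ i < σ'.nat 14 [], ∀ r, k ≤ r → r < N → l < m → a i ≤ a r + I.bp l) ∧
    n + 2 * (N - σ'.nat 14 []) + (σ'.nat 13 [] - σ'.nat 12 []) ≤ k + 2 * N ∧
    (∀ r < N, σ'.real 9 [j, r] ≤ σ.real 9 [j, r]) ∧
    (∀ r < N, σ'.real 9 [j, r] = σ.real 9 [j, r] ∨ ∃ i < N, InWindow I a l lo r i ∧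
        I.line j l (a i - a r) + f i = σ'.real 9 [j, r]) ∧
    (∀ r < k, ∀ i < N, InWindow I a l lo r i →
        σ'.real 9 [j, r] ≤ I.line j l (a i - a r) + f i) ∧
    ∀ j' ≠ j, ∀ r, σ'.real 9 [j', r] = σ.real 9 [j', r]) hW (by simp) ?_ ?_ ?_) ?_
  · intro σ' hag
    rw [eval_var, hag.nat 2 (by simp)]
    simpa using hσ.grid.len
  · refine ⟨?_, by simp, by simp, by simp, by simp, by simp, by simp, by simp⟩
    simp only [State.nat_setNat, eval_lit]
    exact ⟨by simp, by simp, by simp, by simp, by simp⟩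
  · rintro k hk σ₁ n₁ hag₁ h10 ⟨hdq, hiN, hup, hn₁, hle, hsound, hcompl, hold⟩
    have hσ₀ : WindowReady I (((σ.setNat 12 [] 0).setNat 13 [] 0).setNat 14 [] 0) g N a j l f lo :=
      ⟨⟨hσ.grid.loaded.congr (by funext i; simp) rfl rfl rfl rfl, hσ.grid.cum,
        by simpa using hσ.grid.row, by simpa using hσ.grid.len, hσ.grid.entry, hσ.grid.sorted,
        hσ.grid.le, hσ.grid.mem⟩, by simpa using hσ.period, by simpa using hσ.piece, hσ.value,
        hσ.lower⟩
    have hσ₁ := hσ₀.of_agree hag₁ (by simp) (by simp)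
    refine .seq (.imp (reaches_pushProg hσ₁ h10 hdq hiN (fun i hi => hup i hi k le_rfl hk) hW) ?_)
    rintro σ₂ n₂ hag₂ ⟨hdq₂, hiN₂, hup₂, hmax₂, hn₂⟩
    have hσ₂ := hσ₁.of_agree hag₂ (by simp) (by simp)
    have h10₂ : σ₂.nat 10 [] = k := by rw [hag₂.nat 10 (by simp), h10]
    refine .seq (.imp (reaches_popProg hσ₂ h10₂ hdq₂ hiN₂ hW) ?_)
    rintro σ₃ n₃ hag₃ ⟨hdq₃, hhead, hn₃⟩
    have hσ₃ := hσ₂.of_agree hag₃ (by simp) (by simp)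
    have h10₃ : σ₃.nat 10 [] = k := by rw [hag₃.nat 10 (by simp), h10₂]
    have k13 : σ₃.nat 13 = σ₂.nat 13 := hag₃.nat 13 (by simp)
    have k14 : σ₃.nat 14 = σ₂.nat 14 := hag₃.nat 14 (by simp)
    have k15 : σ₃.nat 15 = σ₂.nat 15 := hag₃.nat 15 (by simp)
    have k9 : σ₃.real 9 = σ₁.real 9 := by rw [hag₃.real 9 (by simp), hag₂.real 9 (by simp)]
    rw [← k13, ← k14, ← k15] at hdq₃
    rw [← k13, ← k15] at hhead
    rw [← k14] at hup₂ hmax₂ hiN₂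
    rw [← k13, ← k14] at hn₂
    rw [← k13] at hn₃
    have hup₃ : ∀ i < σ₃.nat 14 [], ∀ r, k + 1 ≤ r → r < N → l < m → a i ≤ a r + I.bp l :=
      fun i hi r hkr hrN hl => (hup₂ i hi hl).trans
        (add_le_add_left (hσ.grid.sorted k r (by omega) hrN) _)
    have hdq₄ := hdq₃.mono (rel' := fun i => ∃ r, k + 1 ≤ r ∧ r < N ∧ a r + lo ≤ a i)
      fun i ⟨r, h₁, h₂, h₃⟩ => ⟨r, by omega, h₂, h₃⟩
    have hcand : candidateExpr.eval h σ₃ = I.line j l (a (σ₃.nat 15 [σ₃.nat 12 []]) - a k) +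
        f (σ₃.nat 15 [σ₃.nat 12 []]) := by
      simp only [candidateExpr, RealExpr.eval_add, RealExpr.eval_sub, RealExpr.eval_mul,
        hσ₃.eval_weight, RealExpr.eval_entry₂, eval_var, eval_entry, hσ₃.period, hσ₃.piece,
        hσ₃.grid.row, hσ₃.grid.entry, h10₃, hσ₃.grid.loaded.setup, hσ₃.grid.loaded.unit, weight,
        Instance.line]
      ring
    -- A level in the window has entered, as those not yet entered lie above it. Its cover weighs no
    -- more than it, and the head weighs least. Costs differ from weights only by terms independent
    -- of `i`.
    have hwin : ∀ i < N, InWindow I a l lo k i → σ₃.nat 12 [] < σ₃.nat 13 [] ∧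
        I.line j l (a (σ₃.nat 15 [σ₃.nat 12 []]) - a k) + f (σ₃.nat 15 [σ₃.nat 12 []]) ≤
          I.line j l (a i - a k) + f i := by
      intro i hi hin
      have hi14 : i < σ₃.nat 14 [] := by
        by_contra hcon
        have := hmax₂ i (not_lt.mp hcon) hi
        linarith [hin.2 this.1, this.2]
      obtain ⟨t, h₁, h₂, -, h₄⟩ := hdq₃.cover i hi14 ⟨k, le_rfl, hk, by linarith [hin.1]⟩
      refine ⟨by omega, ?_⟩
      have := (hdq₃.sorted _ t le_rfl h₁ h₂).trans h₄
      simp only [weight] at this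
      simp only [Instance.line]
      linarith
    refine .ite (fun hb => .storeReal₂ ?_) (fun hb => .skip ?_)
    all_goals
      simp only [Test.holds_and, Test.holds_natLT, Test.holds_realLE, eval_var,
        RealExpr.eval_entry₂, hσ₃.period, h10₃, k9] at hb
    · rw [hcand] at hb
      have hq := hdq₃.lt _ le_rfl hb.1
      simp only [State.nat_setNat, State.real_setNat, State.nat_setReal, State.real_setReal,
        Nat.reduceEqDiff, false_and, if_false, true_and, List.cons.injEq, and_true, eval_var,
        hσ₃.period, h10₃, hcand, k9]
      refine ⟨hdq₄, hiN₂, hup₃, by omega, fun r hr => ?_, fun r hr => ?_, fun r hr i hi hin => ?_,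
        fun j' hj' r => ?_⟩
      · split_ifs with hrk
        · exact hb.2.trans (hrk ▸ hle r hr)
        · exact hle r hr
      · split_ifs with hrk
        · refine Or.inr ⟨σ₃.nat 15 [σ₃.nat 12 []], by omega, ?_, by rw [hrk]⟩
          rw [hrk]
          exact ⟨by linarith [hhead hb.1], fun hl => by linarith [hup₂ _ hq hl]⟩
        · exact hsound r hr
      · split_ifs with hrk
        · rw [hrk] at hin ⊢
          exact (hwin i hi hin).2
        · exact hcompl r (by omega) i hi hin
      · rw [if_neg (fun h' => hj' h'.1)]
        exact hold j' hj' r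
    · simp only [State.nat_setNat, State.real_setNat, Nat.reduceEqDiff, false_and, if_false, k9]
      refine ⟨hdq₄, hiN₂, hup₃, by omega, hle, hsound, fun r hr i hi hin => ?_, hold⟩
      by_cases hrk : r = k
      · rw [hrk] at hin ⊢
        have := hwin i hi hin
        by_contra hcon
        refine hb ⟨this.1, ?_⟩
        rw [hcand]
        exact this.2.trans (not_le.mp hcon).le
      · exact hcompl r (by omega) i hi hin
  · rintro σ' n hag ⟨hdq, hiN, hup, hn, hle, hsound, hcompl, hold⟩
    exact ⟨by omega, hle, hsound, hcompl, hold⟩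

end


/-! ## The dynamic program -/

/-- Cost of the quantity `13` in the last period according to piece `e`. -/
def lastLineExpr (e : NatExpr) : RealExpr :=
  .add (.entry₂ 2 (.sub (var 0) (.lit 1)) e) (.mul (.entry₂ 3 (.sub (var 0) (.lit 1)) e) (.var 13))

/-- The values of the last period. -/
def baseProg (m : ℕ) : Program :=
  forBelow 10 (var 2) <|
    .seq (assignReal 13 (.sub (.entry₂ 6 (.lit 0) (var 0)) (.entry₂ 6 (var 1) (var 10)))) <|
    .seq (storeReal₂ 9 (.sub (var 0) (.lit 1)) (var 10) (lastLineExpr (.lit 0))) <|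
    .seq (forBelow 11 (.lit m) (.ite (.realLE (.var 13) (.entry 1 (var 11))) .skip
      (storeReal₂ 9 (.sub (var 0) (.lit 1)) (var 10) (lastLineExpr (.add (var 11) (.lit 1)))))) <|
    .ite (.realLE (.var 13) (.lit 0)) (storeReal₂ 9 (.sub (var 0) (.lit 1)) (var 10) (.lit 0)) .skip

/-- Cost-to-go of period `9` from the end of the period, and of producing nothing. -/
def initProg : Program :=
  forBelow 10 (var 2) <|
    .seq (storeReal 10 (var 10) (.add (.oracle (var 9) (.sub (.entry₂ 6 (var 1) (var 10))
      (.entry₂ 6 (.lit 0) (.add (var 9) (.lit 1))))) (.entry₂ 9 (.add (var 9) (.lit 1)) (var 10))))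
    (storeReal₂ 9 (var 9) (var 10) (.entry 10 (var 10)))

/-- The values of period `9`. -/
def layerProg (m : ℕ) : Program :=
  .seq initProg <| .seq (assignReal 12 (.lit 0)) <| forBelow 11 (.lit (m + 1)) <|
    .seq (windowProg m) (assignReal 12 (.entry 1 (var 11)))

/-- The values of all periods before the last one. -/
def layersProg (m : ℕ) : Program :=
  forBelow 16 (.sub (var 0) (.lit 1)) <|
    .seq (assignNat 9 (.sub (.sub (var 0) (.lit 2)) (var 16))) (layerProg m)

/-- Copy the values at the levels without inventory to the output. -/
def outputProg : Program :=
  forBelow 9 (var 0) <| forBelow 10 (var 2) <|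
    .ite (.and (.realLE (.entry₂ 6 (var 1) (var 10)) (.entry₂ 6 (.lit 0) (var 9)))
        (.realLE (.entry₂ 6 (.lit 0) (var 9)) (.entry₂ 6 (var 1) (var 10))))
      (storeReal 4 (var 9) (.entry₂ 9 (var 9) (var 10))) .skip

@[simp] theorem natWrites_initProg : initProg.natWrites = [10, 10] := rfl
@[simp] theorem realWrites_initProg : initProg.realWrites = [10, 9] := rfl
@[simp] theorem natWrites_layerProg (m : ℕ) : (layerProg m).natWrites =
    [10, 10, 11, 12, 13, 14, 10, 13, 15, 13, 14, 12, 10, 11] := rfl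
@[simp] theorem realWrites_layerProg (m : ℕ) : (layerProg m).realWrites = [10, 9, 12, 9, 12] := rfl
@[simp] theorem natWrites_baseProg (m : ℕ) : (baseProg m).natWrites = [10, 11, 11, 10] := rfl
@[simp] theorem realWrites_baseProg (m : ℕ) : (baseProg m).realWrites = [13, 9, 9, 9] := rfl
@[simp] theorem natWrites_layersProg (m : ℕ) : (layersProg m).natWrites =
    [16, 9, 10, 10, 11, 12, 13, 14, 10, 13, 15, 13, 14, 12, 10, 11, 16] := rfl
@[simp] theorem realWrites_layersProg (m : ℕ) :
    (layersProg m).realWrites = [10, 9, 12, 9, 12] := rfl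

variable {σ : State} {g N : ℕ} {a : ℕ → ℝ}

/-- The last production is forced, so only its piece has to be found: each breakpoint below the
quantity overwrites the value with that of the next piece, and quantity `0` is corrected at the end.
-/
theorem reaches_baseProg {h : ℕ → ℝ → ℝ} (hT : 1 ≤ T) (hσ : GridReady I σ g N a) (hN : N < W)
    (hm : m < W) :
    Reaches h W (baseProg m) σ fun σ' n => n ≤ N * (m + 1) ∧
      ∀ r < N, σ'.real 9 [T - 1, r] = I.cost (T - 1) (I.cumDemand T - a r) := by
  refine .imp (.forBelow (N := N) (fun k σ' n => n ≤ k * (m + 1) ∧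
    ∀ r < k, σ'.real 9 [T - 1, r] = I.cost (T - 1) (I.cumDemand T - a r)) hN (by simp) ?_ ?_ ?_) ?_
  · intro σ' hag
    rw [eval_var, hag.nat 2 (by simp), hσ.len]
  · simp
  · rintro k hk σ₁ n₁ hag₁ h10 ⟨hn₁, hv₁⟩
    have hσ₁ := hσ.of_agree hag₁ (by simp) (by simp)
    obtain ⟨x, hx⟩ : ∃ x, x = I.cumDemand T - a k := ⟨_, rfl⟩
    have hx0 : 0 ≤ x := hx ▸ sub_nonneg.mpr (hσ.le k hk)
    refine .seq (.assignReal ?_)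
    have he : RealExpr.eval h σ₁ (.sub (.entry₂ 6 (.lit 0) (var 0)) (.entry₂ 6 (var 1) (var 10))) =
        x := by
      simp [hσ₁.loaded.nat, hσ₁.row, h10, hσ₁.entry, hσ₁.cum T le_rfl, hx]
    rw [he]
    refine .seq (.storeReal₂ ?_)
    have hl0 : (lastLineExpr (.lit 0)).eval h (σ₁.setReal 13 [] x) = I.line (T - 1) 0 x := by
      simp [lastLineExpr, hσ₁.loaded.nat, hσ₁.loaded.setup, hσ₁.loaded.unit, Instance.line]
    rw [hl0]
    simp only [eval_sub, eval_var, eval_lit, State.nat_setReal, hσ₁.loaded.nat, h10]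
    refine .seq (.imp (.forBelow (N := m) (fun l σ' n => n = l ∧
      (∀ r < k, σ'.real 9 [T - 1, r] = σ₁.real 9 [T - 1, r]) ∧
      ∃ c ≤ l, σ'.real 9 [T - 1, k] = I.line (T - 1) c x ∧ (∀ i < c, I.bp i < x) ∧
        ∀ i, c ≤ i → i < l → x ≤ I.bp i) hm (by simp) (fun _ _ => rfl) ?_ ?_) ?_)
    · refine ⟨rfl, fun r hr => ?_, 0, le_rfl, by simp, by simp, by simp⟩
      have : r ≠ k := by omega
      simp [this]
    · rintro l hl σ₂ n₂ hag₂ h11 ⟨rfl, hold₂, c, hc, hv₂, hlt, hge⟩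
      have k0 : σ₂.nat 0 [] = T := by rw [hag₂.nat 0 (by simp)]; exact hσ₁.loaded.nat
      have k10 : σ₂.nat 10 [] = k := by rw [hag₂.nat 10 (by simp)]; exact h10
      have k1 : σ₂.real 1 [n₂] = I.bp n₂ := by
        rw [hag₂.real 1 (by simp)]; simpa using hσ₁.loaded.bp n₂
      have k2 : σ₂.real 2 = I.input.real 2 := by
        rw [hag₂.real 2 (by simp), ← hσ₁.loaded.setup]; funext i; simp
      have k3 : σ₂.real 3 = I.input.real 3 := by
        rw [hag₂.real 3 (by simp), ← hσ₁.loaded.unit]; funext i; simp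
      have k13 : σ₂.real 13 [] = x := by rw [hag₂.real 13 (by simp)]; simp
      refine .ite (fun hb => .skip ?_) (fun hb => .storeReal₂ ?_)
      all_goals
        simp only [Test.holds_realLE, RealExpr.eval_var, RealExpr.eval_entry, eval_var, h11, k1,
          k13] at hb
      · refine ⟨by simp, by simpa using hold₂, c, by omega, by simpa using hv₂, hlt,
          fun i h₁ h₂ => ?_⟩
        by_cases hi : i = n₂
        · exact hi ▸ hb
        · exact hge i h₁ (by omega)
      -- Breakpoints increase, so once one is not exceeded no later one is; exceeding this one means
      -- that all earlier ones were exceeded.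
      · have hcn : c = n₂ := by
          by_contra hcon
          exact hb ((hge c le_rfl (by omega)).trans (I.bp_le hc hl))
        refine ⟨by simp, fun r hr => ?_, n₂ + 1, le_rfl, ?_, fun i hi => ?_, by omega⟩
        · have : r ≠ k := by omega
          simp [k10, this, hold₂ r hr]
        · simp [k0, k10, h11, lastLineExpr, k2, k3, k13, Instance.line]
        · by_cases hi' : i = n₂
          · exact hi' ▸ not_le.mp hb
          · exact hlt i (by omega)
    · rintro σ₂ n₂ hag₂ ⟨rfl, hold₂, c, hc, hv₂, hlt, hge⟩
      have k0 : σ₂.nat 0 [] = T := by rw [hag₂.nat 0 (by simp)]; exact hσ₁.loaded.nat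
      have k10 : σ₂.nat 10 [] = k := by rw [hag₂.nat 10 (by simp)]; exact h10
      have k13 : σ₂.real 13 [] = x := by rw [hag₂.real 13 (by simp)]; simp
      have hn : n₁ + (0 + (0 + (n₂ + 0))) + 1 ≤ (k + 1) * (n₂ + 1) := by
        rw [add_mul k 1]; omega
      refine .ite (fun hb => .storeReal₂ ?_) (fun hb => .skip ?_)
      all_goals
        simp only [Test.holds_realLE, RealExpr.eval_var, RealExpr.eval_lit, k13, Nat.cast_zero]
          at hb
        refine ⟨hn, fun r hr => ?_⟩
        by_cases hrk : r = k
      · have : x = 0 := le_antisymm hb hx0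
        rw [hrk, ← hx, this, I.cost_zero]
        simp [k0, k10]
      · simp [k10, hrk, hold₂ r (by omega), hv₁ r (by omega)]
      · rw [hrk, ← hx, I.cost_eq_line (by omega) hc (not_le.mp hb) hlt hge]
        simpa using hv₂
      · simp [hold₂ r (by omega), hv₁ r (by omega)]
  · rintro σ' n hag hp
    exact hp

theorem reaches_initProg {j : ℕ} (hσ : GridReady I σ g N a) (hj : j < T) (h9 : σ.nat 9 [] = j)
    (hN : N < W) :
    Reaches I.oracle W initProg σ fun σ' n => n = N ∧
      (∀ r < N, σ'.real 10 [r] =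
        I.oracle j (a r - I.cumDemand (j + 1)) + σ.real 9 [j + 1, r]) ∧
      (∀ r < N, σ'.real 9 [j, r] = σ'.real 10 [r]) ∧
      ∀ j' ≠ j, ∀ r, σ'.real 9 [j', r] = σ.real 9 [j', r] := by
  refine .imp (.forBelow (N := N) (fun k σ' n => n = k ∧
    (∀ r < k, σ'.real 10 [r] =
      I.oracle j (a r - I.cumDemand (j + 1)) + σ.real 9 [j + 1, r]) ∧
    (∀ r < k, σ'.real 9 [j, r] = σ'.real 10 [r]) ∧
    ∀ j' ≠ j, ∀ r, σ'.real 9 [j', r] = σ.real 9 [j', r]) hN (by simp) ?_ ?_ ?_) ?_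
  · intro σ' hag
    rw [eval_var, hag.nat 2 (by simp), hσ.len]
  · simp
  · rintro k hk σ₁ n₁ hag₁ h10 ⟨rfl, hf, hv, hold⟩
    have hσ₁ := hσ.of_agree hag₁ (by simp) (by simp)
    have k9 : σ₁.nat 9 [] = j := by rw [hag₁.nat 9 (by simp), h9]
    refine .seq (.storeReal (.storeReal₂ ?_))
    simp only [eval_var, eval_add, eval_lit, RealExpr.eval_add, RealExpr.eval_sub,
      RealExpr.eval_oracle, RealExpr.eval_entry, RealExpr.eval_entry₂, State.real_setNat,
      State.nat_setReal, State.real_setReal, h10, k9, hσ₁.row, hσ₁.entry, hσ₁.cum (j + 1) hj,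
      hold (j + 1) (by omega)]
    refine ⟨by simp, fun r hr => ?_, fun r hr => ?_, fun j' hj' r => ?_⟩
    · by_cases hrk : r = n₁
      · simp [hrk]
      · simp [hrk, hf r (by omega)]
    · by_cases hrk : r = n₁
      · simp [hrk]
      · simp [hrk, hv r (by omega)]
    · simp [hj', hold j' hj' r]
  · rintro σ' n hag hp
    exact hp

/-- Lower end of piece `l`. -/
noncomputable def Instance.lowerEnd (I : Instance m T) : ℕ → ℝ
  | 0 => 0
  | l + 1 => I.bp l

theorem lowerEnd_nonneg {l : ℕ} (hl : l ≤ m) : 0 ≤ I.lowerEnd l := by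
  cases l with
  | zero => exact le_rfl
  | succ l => exact (I.bp_pos hl).le

theorem bp_le_lowerEnd {l i : ℕ} (hl : l ≤ m) (hi : i < l) : I.bp i ≤ I.lowerEnd l := by
  cases l with
  | zero => omega
  | succ l => exact I.bp_le (by omega) hl

theorem InWindow.nonneg {l r i : ℕ} (hl : l ≤ m) (h : InWindow I a l (I.lowerEnd l) r i) :
    0 ≤ a i - a r := (lowerEnd_nonneg hl).trans h.1

/-- Soundness of closed windows: a candidate is never cheaper than the real production. -/
theorem InWindow.cost_le (hlsc : ∀ j, LowerSemicontinuousOn (I.prodCost j) (Set.Ici 0))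
    {j l r i : ℕ} (hj : j < T) (hl : l ≤ m) (h : InWindow I a l (I.lowerEnd l) r i) :
    I.cost j (a i - a r) ≤ I.line j l (a i - a r) :=
  I.cost_le_line hlsc hj hl (h.nonneg hl) (fun _ hi => (bp_le_lowerEnd hl hi).trans h.1)
    fun _ h₁ h₂ => (h.2 (by omega)).trans (I.bp_le h₁ h₂)

/-- Completeness of the windows: every positive production is priced exactly by one of them. -/
theorem exists_inWindow {j r i : ℕ} (hj : j < T) (hlt : a r < a i) :
    ∃ l ≤ m, InWindow I a l (I.lowerEnd l) r i ∧
      I.cost j (a i - a r) = I.line j l (a i - a r) := by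
  obtain ⟨l, hl, h₁, h₂⟩ := I.exists_piece (a i - a r)
  refine ⟨l, hl, ⟨?_, fun hlm => h₂ l le_rfl hlm⟩, I.cost_eq_line hj hl (sub_pos.mpr hlt) h₁ h₂⟩
  cases l with
  | zero => exact (sub_pos.mpr hlt).le
  | succ l => exact (h₁ l (by omega)).le

/-- Start from producing nothing and improve by each piece in turn. Throughout, every value is
justified by some move, and it is at most all candidates of the pieces treated; after the last piece
`isPathValue_step` applies. -/
theorem reaches_layerProg (hlsc : ∀ j, LowerSemicontinuousOn (I.prodCost j) (Set.Ici 0)) {j : ℕ}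
    (hσ : GridReady I σ g N a) (hj : j < T) (h9 : σ.nat 9 [] = j) (hN : N < W) (hm : m + 1 < W)
    (hv : ∀ r < N, I.IsPathValue {z | ∃ r < N, a r = z} (j + 1) (a r) (σ.real 9 [j + 1, r])) :
    Reaches I.oracle W (layerProg m) σ fun σ' n => n ≤ N + (m + 1) * (3 * N + 1) ∧
      (∀ r < N, I.IsPathValue {z | ∃ r < N, a r = z} j (a r) (σ'.real 9 [j, r])) ∧
      ∀ j' ≠ j, ∀ r, σ'.real 9 [j', r] = σ.real 9 [j', r] := by
  refine .seq (.imp (reaches_initProg hσ hj h9 hN) ?_)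
  rintro σ₁ n₁ hag₁ ⟨rfl, hf, hv₁, hold₁⟩
  have hσ₁ := hσ.of_agree hag₁ (by simp) (by simp)
  have k9 : σ₁.nat 9 [] = j := by rw [hag₁.nat 9 (by simp), h9]
  obtain ⟨f, hf'⟩ : ∃ f : ℕ → ℝ, ∀ r, σ₁.real 10 [r] = f r := ⟨_, fun _ => rfl⟩
  simp only [hf'] at hf hv₁
  refine .seq (.assignReal (.imp (.forBelow (N := m + 1) (fun l σ' n => n ≤ l * (3 * n₁ + 1) ∧
    σ'.real 12 [] = I.lowerEnd l ∧ (∀ r < n₁, σ'.real 9 [j, r] ≤ f r) ∧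
    (∀ r < n₁, ∃ i < n₁, a r ≤ a i ∧ I.cost j (a i - a r) + f i ≤ σ'.real 9 [j, r]) ∧
    (∀ l' < l, ∀ r < n₁, ∀ i < n₁, InWindow I a l' (I.lowerEnd l') r i →
      σ'.real 9 [j, r] ≤ I.line j l' (a i - a r) + f i) ∧
    ∀ j' ≠ j, ∀ r, σ'.real 9 [j', r] = σ₁.real 9 [j', r]) hm (by simp) (fun _ _ => rfl) ?_ ?_)
    ?_))
  · refine ⟨by simp, by simp [Instance.lowerEnd], ?_, ?_, by simp, by simp⟩
    · intro r hr
      simpa using (hv₁ r hr).le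
    · intro r hr
      exact ⟨r, hr, le_rfl, by simp [I.cost_zero, hv₁ r hr]⟩
  · rintro l hl σ₂ n₂ hag₂ h11 ⟨hn₂, hlo, hle, hsound, hcompl, hold⟩
    have hσ₂ : WindowReady I σ₂ g n₁ a j l f (I.lowerEnd l) := by
      have h' : GridReady I (σ₁.setReal 12 [] (RealExpr.eval I.oracle σ₁ (.lit 0))) g n₁ a :=
        ⟨hσ₁.loaded.congr rfl (by funext i; simp) (by funext i; simp) (by funext i; simp)
          (by funext i; simp), fun j hj => by simpa using hσ₁.cum j hj, hσ₁.row, hσ₁.len,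
          fun r => by simpa using hσ₁.entry r, hσ₁.sorted, hσ₁.le, hσ₁.mem⟩
      refine ⟨h'.of_agree hag₂ (by simp) (by simp), ?_, h11, fun r => ?_, hlo⟩
      · rw [hag₂.nat 9 (by simp)]; exact k9
      · rw [hag₂.real 10 (by simp)]; simpa using hf' r
    refine .seq (.imp (reaches_windowProg hσ₂ hN) ?_)
    rintro σ₃ n₃ hag₃ ⟨hn₃, hle₃, hsound₃, hcompl₃, hold₃⟩
    have k11 : σ₃.nat 11 [] = l := by rw [hag₃.nat 11 (by simp), h11]
    have k1 : σ₃.real 1 [l] = I.bp l := by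
      rw [hag₃.real 1 (by simp)]; exact hσ₂.grid.loaded.bp l
    -- The upper end of this piece is the lower end of the next. After the last piece the cell past
    -- the breakpoints is read; no window uses that value.
    refine .assignReal ?_
    have hreal : ∀ i, ((σ₃.setReal 12 [] (RealExpr.eval I.oracle σ₃ (.entry 1 (var 11)))).setNat 11 []
        (l + 1)).real 9 i = σ₃.real 9 i := fun i => by simp
    simp only [hreal]
    refine ⟨?_, by simp [k11, k1, Instance.lowerEnd], fun r hr => (hle₃ r hr).trans (hle r hr),
      fun r hr => ?_, fun l' hl' r hr i hi hin => ?_, fun j' hj' r => ?_⟩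
    · rw [add_mul l 1]; omega
    · rcases hsound₃ r hr with he | ⟨i, hi, hin, he⟩
      · rw [he]
        exact hsound r hr
      · have h₁ := hin.cost_le hlsc hj (by omega)
        exact ⟨i, hi, sub_nonneg.mp (hin.nonneg (by omega)), by linarith⟩
    · by_cases hll : l' = l
      · subst hll
        exact hcompl₃ r hr i hi hin
      · exact (hle₃ r hr).trans (hcompl l' (by omega) r hr i hi hin)
    · rw [hold₃ j' hj' r, hold j' hj' r]
  · rintro σ₂ n₂ hag₂ ⟨hn₂, hlo, hle, hsound, hcompl, hold⟩
    refine ⟨by omega, fun r hr => ?_, fun j' hj' r => by rw [hold j' hj' r, hold₁ j' hj' r]⟩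
    refine I.isPathValue_step hj hv hr ?_ ?_ fun i hi hlt => ?_
    · obtain ⟨i, hi, h₁, h₂⟩ := hsound r hr
      exact ⟨i, hi, h₁, by rwa [← hf i hi]⟩
    · rw [← hf r hr]
      exact hle r hr
    · obtain ⟨l, hl, hin, he⟩ := exists_inWindow (I := I) (j := j) hj hlt
      rw [he, ← hf i hi]
      exact hcompl l (by omega) r hr i hi hin

theorem reaches_layersProg (hlsc : ∀ j, LowerSemicontinuousOn (I.prodCost j) (Set.Ici 0))
    (hσ : GridReady I σ g N a) (hT : T < W) (hN : N < W) (hm : m + 1 < W)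
    (hv : ∀ r < N, I.IsPathValue {z | ∃ r < N, a r = z} (T - 1) (a r) (σ.real 9 [T - 1, r])) :
    Reaches I.oracle W (layersProg m) σ fun σ' n =>
      n ≤ (T - 1) * (N + (m + 1) * (3 * N + 1) + 1) ∧
      ∀ j < T, ∀ r < N, I.IsPathValue {z | ∃ r < N, a r = z} j (a r) (σ'.real 9 [j, r]) := by
  refine .imp (.forBelow (N := T - 1) (fun k σ' n =>
    n ≤ k * (N + (m + 1) * (3 * N + 1) + 1) ∧ ∀ j, T - 1 - k ≤ j → j < T → ∀ r < N,
      I.IsPathValue {z | ∃ r < N, a r = z} j (a r) (σ'.real 9 [j, r])) (by omega) (by simp)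
      ?_ ?_ ?_) ?_
  · intro σ' hag
    rw [eval_sub, eval_var, hag.nat 0 (by simp), hσ.loaded.nat, eval_lit]
  · refine ⟨by simp, fun j h₁ h₂ r hr => ?_⟩
    have : j = T - 1 := by omega
    rw [this]
    exact hv r hr
  · rintro k hk σ₁ n₁ hag₁ h16 ⟨hn₁, hv₁⟩
    have hσ₁ := hσ.of_agree hag₁ (by simp) (by simp)
    -- The body runs only for `k < T - 1`, so the truncated subtractions are exact.
    have he : NatExpr.eval σ₁ (.sub (.sub (var 0) (.lit 2)) (var 16)) = T - 2 - k := by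
      simp [hσ₁.loaded.nat, h16]
    refine .seq (.assignNat (by rw [he]; omega) ?_)
    rw [he]
    have hσ₂ : GridReady I (σ₁.setNat 9 [] (T - 2 - k)) g N a :=
      ⟨hσ₁.loaded.congr (by funext i; simp) rfl rfl rfl rfl, hσ₁.cum, by simpa using hσ₁.row,
        by simpa using hσ₁.len, hσ₁.entry, hσ₁.sorted, hσ₁.le, hσ₁.mem⟩
    refine .imp (reaches_layerProg hlsc hσ₂ (j := T - 2 - k) (by omega) (by simp) hN hm
      fun r hr => hv₁ (T - 2 - k + 1) (by omega) (by omega) r hr) ?_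
    rintro σ₃ n₃ hag₃ ⟨hn₃, hv₃, hold₃⟩
    refine ⟨by rw [add_mul k 1]; omega, fun j h₁ h₂ r hr => ?_⟩
    rw [State.real_setNat]
    by_cases hjk : j = T - 2 - k
    · rw [hjk]
      exact hv₃ r hr
    · rw [hold₃ j hjk r]
      exact hv₁ j (by omega) h₂ r hr
  · rintro σ' n hag ⟨hn, hp⟩
    exact ⟨hn, fun j hj => hp j (by omega) hj⟩

/-- A full scan per period fits the time bound. `D j` is found because it is the level with all
coefficients `0`; with duplicates, any match holds a correct value. -/
theorem reaches_outputProg {h : ℕ → ℝ → ℝ} {Z : Set ℝ} (hσ : GridReady I σ g N a) (hT : T < W)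
    (hN : N < W)
    (hv : ∀ j < T, ∀ r < N, I.IsPathValue Z j (a r) (σ.real 9 [j, r])) :
    Reaches h W outputProg σ fun σ' n => n ≤ T * (N + 1) ∧
      ∀ j < T, I.IsPathValue Z j (I.cumDemand j) (σ'.real 4 [j]) := by
  refine .imp (.forBelow (N := T) (fun k σ' n => n ≤ k * (N + 1) ∧
      ∀ j < k, I.IsPathValue Z j (I.cumDemand j) (σ'.real 4 [j])) hT (by simp) ?_ ?_ ?_) ?_
  · intro σ' hag
    rw [eval_var, hag.nat 0 (by simp), hσ.loaded.nat]
  · simp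
  · rintro k hk σ₁ n₁ hag₁ h9 ⟨hn₁, hv₁⟩
    have hσ₁ := hσ.of_agree hag₁ (by simp) (by simp)
    have hr9 : σ₁.real 9 = σ.real 9 := hag₁.real 9 (by simp)
    refine .imp (.forBelow (N := N) (fun r σ' n => n = r ∧
      (∀ j < k, I.IsPathValue Z j (I.cumDemand j) (σ'.real 4 [j])) ∧
      ((∃ r' < r, a r' = I.cumDemand k) → I.IsPathValue Z k (I.cumDemand k) (σ'.real 4 [k])))
      hN (by simp) ?_ ?_ ?_) ?_
    · intro σ' hag
      rw [eval_var, hag.nat 2 (by simp), hσ₁.len]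
    · exact ⟨rfl, hv₁, by simp⟩
    · rintro r hr σ₂ n₂ hag₂ h10 ⟨rfl, hv₂, hk₂⟩
      have hσ₂ := hσ₁.of_agree hag₂ (by simp) (by simp)
      have k9 : σ₂.nat 9 [] = k := by rw [hag₂.nat 9 (by simp), h9]
      have hr9' : σ₂.real 9 = σ.real 9 := by rw [hag₂.real 9 (by simp), hr9]
      refine .ite (fun hb => .storeReal ?_) (fun hb => .skip ?_)
      all_goals
        simp only [Test.holds_and, Test.holds_realLE, RealExpr.eval_entry₂, eval_var, eval_lit,
          hσ₂.row, hσ₂.entry, h10, k9, hσ₂.cum k hk.le, ← le_antisymm_iff] at hb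
      · refine ⟨by simp, fun j hj => ?_, fun _ => ?_⟩
        · have : j ≠ k := by omega
          simpa [k9, this] using hv₂ j hj
        · have := hv k hk n₂ hr
          rw [hb] at this
          simpa [k9, h10, hr9'] using this
      · refine ⟨by simp, hv₂, ?_⟩
        rintro ⟨r', hr', he⟩
        refine hk₂ ⟨r', ?_, he⟩
        have : r' ≠ n₂ := fun h' => hb (h' ▸ he)
        omega
    · rintro σ₂ n₂ hag₂ ⟨rfl, hv₂, hk₂⟩
      refine ⟨by rw [add_mul k 1]; omega, fun j hj => ?_⟩
      rw [State.real_setNat]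
      by_cases hjk : j = k
      · rw [hjk]
        refine hk₂ (hσ.mem _ ?_ (I.cumDemand_mono hk.le))
        simpa using I.mem_levels hk.le 0 (by simp) m
      · exact hv₂ j (by omega)
  · rintro σ' n hag hp
    exact hp

/-! ### Assembly and the final time and word bounds -/

/-- The algorithm for instances with `m` breakpoints. -/
def lotSizingProg (m : ℕ) : Program :=
  .seq (gridProg m) <| .seq (baseProg m) <| .seq (layersProg m) outputProg

theorem reaches_lotSizingProg (hlsc : ∀ j, LowerSemicontinuousOn (I.prodCost j) (Set.Ici 0))
    (hT : 1 ≤ T) (hW : gridSize m T + 2 * T * m + m + 2 < W) :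
    Reaches I.oracle W (lotSizingProg m) I.input fun σ' n =>
      n ≤ T + m * (T * (2 * gridSize m T + 1) + 1) + gridSize m T + gridSize m T * (m + 1) +
        T * (gridSize m T + (m + 1) * (3 * gridSize m T + 1) + 1) + T * (gridSize m T + 1) ∧
      ∀ u : Fin T, I.IsCostToGo u (σ'.output u) := by
  have hTG : T + 1 ≤ gridSize m T := Nat.le_mul_of_pos_right _ (pow_pos (by omega) _)
  refine .seq (.imp (reaches_gridProg (by omega)) ?_)
  rintro σ₁ n₁ - ⟨hn₁, g, N, a, hNG, hσ₁⟩
  refine .seq (.imp (reaches_baseProg hT hσ₁ (by omega) (by omega)) ?_)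
  rintro σ₂ n₂ hag₂ ⟨hn₂, hv₂⟩
  have hσ₂ := hσ₁.of_agree hag₂ (by simp) (by simp)
  refine .seq (.imp (reaches_layersProg hlsc hσ₂ (by omega) (by omega) (by omega) fun r hr => by
    rw [hv₂ r hr]
    exact I.isPathValue_last hT _ (hσ₂.le r hr)) ?_)
  rintro σ₃ n₃ hag₃ ⟨hn₃, hv₃⟩
  have hσ₃ := hσ₂.of_agree hag₃ (by simp) (by simp)
  refine .imp (reaches_outputProg hσ₃ (by omega) (by omega) hv₃) ?_
  rintro σ₄ n₄ - ⟨hn₄, hv₄⟩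
  refine ⟨?_, fun u => I.isCostToGo_of_isPathValue hlsc hσ₃.mem (hv₄ u u.2)⟩
  have e₂ : N * (m + 1) ≤ gridSize m T * (m + 1) := Nat.mul_le_mul_right _ hNG
  have e₃ : (T - 1) * (N + (m + 1) * (3 * N + 1) + 1) ≤
      T * (gridSize m T + (m + 1) * (3 * gridSize m T + 1) + 1) := by
    gcongr
    omega
  have e₄ : T * (N + 1) ≤ T * (gridSize m T + 1) := by gcongr
  omega

theorem gridSize_le (hT : 1 ≤ T) : gridSize m T ≤ 2 * 3 ^ m * T ^ (m + 1) := by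
  calc gridSize m T ≤ (2 * T) * (3 * T) ^ m := by
        unfold gridSize
        gcongr <;> omega
    _ = _ := by rw [mul_pow]; ring

end LotSizing

theorem theorem4 (m : ℕ) :
    ∃ (prog : LotSizing.Program) (K C : ℕ),
      ∀ (T : ℕ), 1 ≤ T → ∀ I : LotSizing.Instance m T,
        (∀ j, LowerSemicontinuousOn (I.prodCost j) (Set.Ici 0)) →
        ∃ (σ : LotSizing.State) (t : ℕ),
          LotSizing.Exec I.oracle (K * T ^ K) prog I.input σ t ∧
          t ≤ C * T ^ (m + 2) ∧
          ∀ u : Fin T, I.IsCostToGo u (σ.output u) := by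
  obtain ⟨B, hB⟩ : ∃ B, B = 2 * 3 ^ m := ⟨_, rfl⟩
  -- `K` is both factor and exponent of the word bound: `B` covers the grid size, `3 * m` the terms
  -- `2 * T * m` and `m`, and `3` the rest. In the time bound, `(8 + 6 * m) * B` absorbs the
  -- multiples of `T * G` and `G` (`G` the grid size), and `3 * m + 6` those of `T` and `1`.
  refine ⟨LotSizing.lotSizingProg m, B + 3 * m + 3,
    (LotSizing.lotSizingProg m).size * ((8 + 6 * m) * B + 3 * m + 6),
    fun T hT I hlsc => ?_⟩
  have hG := LotSizing.gridSize_le (m := m) hT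
  rw [← hB] at hG
  obtain ⟨G, hGe⟩ : ∃ G, G = LotSizing.gridSize m T := ⟨_, rfl⟩
  rw [← hGe] at hG
  have hW : LotSizing.gridSize m T + 2 * T * m + m + 2 <
      (B + 3 * m + 3) * T ^ (B + 3 * m + 3) := by
    rw [← hGe]
    have h₁ : T ^ (m + 1) ≤ T ^ (B + 3 * m + 3) := Nat.pow_le_pow_right hT (by omega)
    have h₂ : T ≤ T ^ (B + 3 * m + 3) := Nat.le_self_pow (by omega) T
    generalize T ^ (B + 3 * m + 3) = Q at h₁ h₂
    have h₃ : B * T ^ (m + 1) ≤ B * Q := Nat.mul_le_mul_left _ h₁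
    have h₄ : T * m ≤ Q * m := Nat.mul_le_mul_right _ h₂
    have h₅ : 1 * m ≤ Q * m := Nat.mul_le_mul_right _ (hT.trans h₂)
    have h₆ : (B + 3 * m + 3) * Q = B * Q + 3 * (Q * m) + 3 * Q := by ring
    have h₇ : 2 * T * m = 2 * (T * m) := by ring
    omega
  obtain ⟨σ, t, n, he, ht, hn, hσ⟩ := LotSizing.reaches_lotSizingProg hlsc hT hW
  refine ⟨σ, t, he, ht.trans ?_, hσ⟩
  rw [mul_assoc]
  refine Nat.mul_le_mul_left _ ?_
  rw [← hGe] at hn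
  have hP : T ≤ T ^ (m + 2) := Nat.le_self_pow (by omega) T
  have hTG : T * G ≤ B * T ^ (m + 2) := by
    calc T * G ≤ T * (B * T ^ (m + 1)) := Nat.mul_le_mul_left _ hG
      _ = B * T ^ (m + 2) := by ring
  have hGP : G ≤ B * T ^ (m + 2) := (Nat.le_mul_of_pos_left _ hT).trans hTG
  generalize T ^ (m + 2) = Q at hP hTG hGP ⊢
  have e₁ : m * (T * (2 * G + 1) + 1) = 2 * (m * (T * G)) + m * T + m * 1 := by ring
  have e₂ : G * (m + 1) = m * G + G := by ring
  have e₃ : T * (G + (m + 1) * (3 * G + 1) + 1) =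
      3 * (m * (T * G)) + 4 * (T * G) + m * T + 2 * T := by ring
  have e₄ : T * (G + 1) = T * G + T := by ring
  have e₅ : ((8 + 6 * m) * B + 3 * m + 6) * Q =
      8 * (B * Q) + 6 * (m * (B * Q)) + 3 * (m * Q) + 6 * Q := by ring
  have l₁ : m * (T * G) ≤ m * (B * Q) := Nat.mul_le_mul_left _ hTG
  have l₂ : m * T ≤ m * Q := Nat.mul_le_mul_left _ hP
  have l₃ : m * 1 ≤ m * Q := Nat.mul_le_mul_left _ (hT.trans hP)
  have l₄ : m * G ≤ m * (B * Q) := Nat.mul_le_mul_left _ hGP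
  omega
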